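/- A *convex polyhedron* is a bounded intersection of finitely many closed half-spaces of $\mathbb{R}^3$ with non-empty interior. It is *$k$-equiprojective* if its orthogonal projection along every direction that is not parallel to one of its (two-dimensional) faces is a convex $k$-gon. A *$k$-gonal prism* is the set $B+[0,u]$, where $B$ is a planar convex $k$-gon in $\mathbb{R}^3$ and $u$ is a vector not parallel to the plane of $B$; its *lateral faces* are the parallelograms $e+[0,u]$ with $e$ an edge of $B$. Let $P_1$ be a $k_1$-gonal prism and $P_2$ a $k_2$-gonal prism such that $P_1\cap P_2=F$ is a lateral face of both $P_1$ and $P_2$. Suppose that $P=P_1\cup P_2$ is convex and that each of the four vertices of $F$ is a vertex (extreme point) of $P$; such a $P$ is called an *equiprojective bi-prism*. **Theorem.** Every equiprojective bi-prism $P=P_1\cup P_2$ obtained from a $k_1$-gonal prism and a $k_2$-gonal prism is a $(k_1+k_2)$-equiprojective convex polyhedron. -/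

import Mathlib

open scoped Pointwise

/-- Euclidean three-space. -/
abbrev E3 : Type := EuclideanSpace ℝ (Fin 3)

/-- A (planar, non-degenerate) convex `k`-gon in space: the convex hull of finitely many points
which spans a plane and has exactly `k` vertices. -/
def IsConvexPolygon (k : ℕ) (Q : Set E3) : Prop :=
  (∃ s : Set E3, s.Finite ∧ Q = convexHull ℝ s) ∧
    Module.finrank ℝ (vectorSpan ℝ Q) = 2 ∧
    (Q.extremePoints ℝ).ncard = k

/-- A (three-dimensional, bounded) convex polyhedron: a bounded intersection of finitely many
closed half-spaces `{x | ⟪a, x⟫ ≤ b}`, `a ≠ 0`, with non-empty interior. -/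
def IsConvexPolyhedron (P : Set E3) : Prop :=
  Bornology.IsBounded P ∧ (interior P).Nonempty ∧
    ∃ H : Set (E3 × ℝ), H.Finite ∧ (∀ h ∈ H, h.1 ≠ 0) ∧
      P = {x : E3 | ∀ h ∈ H, inner ℝ h.1 x ≤ h.2}

/-- `f` is an `m`-dimensional face of the convex set `A` (for `m ≥ 1`): the set of maximisers on
`A` of some linear functional, of affine dimension `m`.
The faces of a polyhedron are those with `m = 2`, the edges of a polygon those with `m = 1`. -/
def IsFaceOfDim (m : ℕ) (A f : Set E3) : Prop :=
  IsExposed ℝ A f ∧ Module.finrank ℝ (vectorSpan ℝ f) = m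

/-- The shadow of `P` in direction `d`: its orthogonal projection onto the plane `dᗮ`. -/
noncomputable def shadow (d : E3) (P : Set E3) : Set E3 :=
  (ℝ ∙ d)ᗮ.starProjection '' P

/-- `P` is a `k`-equiprojective polyhedron: a convex polyhedron whose shadow is a `k`-gon in every
direction that is not parallel to a face of `P`. -/
def IsEquiprojective (k : ℕ) (P : Set E3) : Prop :=
  IsConvexPolyhedron P ∧
    ∀ d : E3, d ≠ 0 → (∀ f : Set E3, IsFaceOfDim 2 P f → d ∉ vectorSpan ℝ f) →
      IsConvexPolygon k (shadow d P)

/-- The union of all translates of `A` by `t • u`, `0 ≤ t ≤ 1`. -/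
def sweep (A : Set E3) (u : E3) : Set E3 :=
  A + segment ℝ 0 u

/-- `P` is a (right or oblique) `k`-gonal prism and `F` is one of its lateral faces:
`P` is swept out by a convex `k`-gon `B` under a translation `u` not parallel to its plane, so that
its bases are `B` and `u + B`, and `F` is the parallelogram swept out by an edge `e` of `B`. -/
def IsPrismWithLateralFace (k : ℕ) (P F : Set E3) : Prop :=
  ∃ (B : Set E3) (u : E3), IsConvexPolygon k B ∧ u ∉ vectorSpan ℝ B ∧ P = sweep B u ∧
    ∃ e : Set E3, IsFaceOfDim 1 B e ∧ F = sweep e u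

/-- `P` is an equiprojective bi-prism: a `k₁`-gonal and a `k₂`-gonal prism meeting exactly in a
common lateral face `F`, such that their union `P` is convex and the vertices of `F` are
vertices of `P`. -/
def IsBiPrism (k₁ k₂ : ℕ) (P : Set E3) : Prop :=
  ∃ P₁ P₂ F : Set E3,
    IsPrismWithLateralFace k₁ P₁ F ∧ IsPrismWithLateralFace k₂ P₂ F ∧
      P₁ ∩ P₂ = F ∧ P = P₁ ∪ P₂ ∧ Convex ℝ P ∧
      F.extremePoints ℝ ⊆ P.extremePoints ℝ

/-!
Let `F` be the common lateral face. Extreme points satisfy inclusion–exclusion for a convex union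
of two closed convex sets, provided that the extreme points of the intersection are either interior
to the union or extreme in it; for the shadows of the two prisms this holds because a vertex of `P`
can only be projected to a vertex or to an interior point of the shadow of `P`. As the two shadows
meet in the shadow of `F`, their vertices number `k₁ + k₂` together with those of the shadow of `F`,
once each prism is shown to satisfy `2 * #vertices = 2 * k + #vertices of the shadow of F`.

The last formula is planar. The shadow of a prism is `Q + [0, u]` with `Q` a convex `k`-gon, and its
number of vertices exceeds that of `Q` by the number of vertices of `Q` at which a line parallel to
`u` supports `Q` in a single point. If the projection is not parallel to `F`, there are two of them,
and the shadow of `F` is a parallelogram. Otherwise one of the two supporting lines contains the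
edge of `Q` below `F`, so there is only one, and the shadow of `F` is a segment.
-/

open Set Topology

/-! ### Extreme points -/

section ExtremePoints

theorem eventually_add_smul_mem {V : Type*} [AddCommGroup V] [Module ℝ V] [TopologicalSpace V]
    [ContinuousAdd V] [ContinuousSMul ℝ V] {N : Set V} {x : V} (hN : N ∈ 𝓝 x) (v : V) :
    ∀ᶠ t : ℝ in 𝓝[>] 0, x + t • v ∈ N :=
  ((by fun_prop : Continuous fun t : ℝ => x + t • v).tendsto' 0 x (by simp)).mono_left
    nhdsWithin_le_nhds hN

variable {V W : Type*} [AddCommGroup V] [Module ℝ V] [AddCommGroup W] [Module ℝ W]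

theorem eq_zero_of_add_smul_mem_of_sub_smul_mem {A : Set V} {x v : V} {s t : ℝ}
    (hx : x ∈ A.extremePoints ℝ) (hs : 0 < s) (ht : 0 < t) (hxs : x + s • v ∈ A)
    (hxt : x - t • v ∈ A) : v = 0 := by
  have hmem : x ∈ openSegment ℝ (x + s • v) (x - t • v) := by
    refine ⟨t / (s + t), s / (s + t), by positivity, by positivity, by field_simp; ring, ?_⟩
    match_scalars <;> field_simp <;> ring
  simpa [hs.ne'] using hx.2 hxs hxt hmem

theorem eq_zero_of_add_mem_of_sub_mem {A : Set V} {x v : V} (hx : x ∈ A.extremePoints ℝ)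
    (hadd : x + v ∈ A) (hsub : x - v ∈ A) : v = 0 :=
  eq_zero_of_add_smul_mem_of_sub_smul_mem hx one_pos one_pos (by simpa using hadd)
    (by simpa using hsub)

theorem isExtreme_image_of_injOn {A B : Set V} (f : V →ᵃ[ℝ] W) (hA : Convex ℝ A)
    (hf : InjOn f A) (hAB : IsExtreme ℝ A B) : IsExtreme ℝ (f '' A) (f '' B) := by
  refine ⟨image_mono hAB.subset, ?_⟩
  rintro _ ⟨x, hx, rfl⟩ _ ⟨y, hy, rfl⟩ _ ⟨z, hz, rfl⟩ hxyz
  rw [← image_openSegment] at hxyz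
  obtain ⟨w, hw, hwz⟩ := hxyz
  obtain rfl := hf (hA.openSegment_subset hx hy hw) (hAB.subset hz) hwz
  exact mem_image_of_mem f (hAB.left_mem_of_mem_openSegment hx hy hz hw)

theorem extremePoints_image_of_injOn {A : Set V} (f : V →ᵃ[ℝ] W) (hA : Convex ℝ A)
    (hf : InjOn f A) : (f '' A).extremePoints ℝ = f '' A.extremePoints ℝ := by
  refine Subset.antisymm ?_ (image_subset_iff.2 fun x hx => ?_)
  · rintro _ ⟨⟨x, hx, rfl⟩, hext⟩
    refine mem_image_of_mem f ⟨hx, fun y hy z hz hxyz => ?_⟩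
    have : f x ∈ openSegment ℝ (f y) (f z) := by
      rw [← image_openSegment]
      exact mem_image_of_mem f hxyz
    exact hf hy hx (hext (mem_image_of_mem f hy) (mem_image_of_mem f hz) this)
  · simpa using isExtreme_image_of_injOn f hA hf (isExtreme_singleton.2 hx)

theorem extremePoints_segment (a b : V) : (segment ℝ a b).extremePoints ℝ = {a, b} := by
  rcases eq_or_ne a b with rfl | hab
  · simp
  · rw [segment_eq_image_lineMap, extremePoints_image_of_injOn _ (convex_Icc 0 1)
      (AffineMap.lineMap_injective ℝ hab).injOn, extremePoints_Icc zero_le_one]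
    simp [image_pair]

theorem lineMap_mem_segment_of_isExtreme {Q : Set V} {a b : V}
    (hab : IsExtreme ℝ Q (segment ℝ a b)) {s : ℝ} (hs : AffineMap.lineMap a b s ∈ Q) :
    AffineMap.lineMap a b s ∈ segment ℝ a b := by
  have ha := left_mem_segment ℝ a b
  have hb := right_mem_segment ℝ a b
  rcases lt_or_ge s 0 with hneg | hpos
  · refine hab.left_mem_of_mem_openSegment hs (hab.subset hb) ha ?_
    have : (0 : ℝ) ∈ openSegment ℝ s 1 := by
      rw [openSegment_eq_Ioo (by linarith)]
      exact ⟨hneg, one_pos⟩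
    simpa [image_openSegment] using mem_image_of_mem (AffineMap.lineMap (k := ℝ) a b) this
  rcases le_or_gt s 1 with hle | hgt
  · rw [segment_eq_image_lineMap]
    exact mem_image_of_mem _ ⟨hpos, hle⟩
  · refine hab.right_mem_of_mem_openSegment (hab.subset ha) hs hb ?_
    have : (1 : ℝ) ∈ openSegment ℝ 0 s := by
      rw [openSegment_eq_Ioo (by linarith)]
      exact ⟨one_pos, hgt⟩
    simpa [image_openSegment] using mem_image_of_mem (AffineMap.lineMap (k := ℝ) a b) this

theorem mem_extremePoints_of_mem_extremePoints_inter_nhds {V : Type*} [AddCommGroup V]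
    [Module ℝ V] [TopologicalSpace V] [ContinuousAdd V] [ContinuousSMul ℝ V] {A N : Set V} {x : V}
    (hA : Convex ℝ A) (hN : N ∈ 𝓝 x) (hx : x ∈ (A ∩ N).extremePoints ℝ) :
    x ∈ A.extremePoints ℝ := by
  refine ⟨hx.1.1, fun y hy z hz hxyz => ?_⟩
  obtain ⟨t, hty, htz, ht0, ht1⟩ := ((eventually_add_smul_mem hN (y - x)).and
    ((eventually_add_smul_mem hN (z - x)).and (Ioo_mem_nhdsGT (one_pos (α := ℝ))))).exists
  have shrink_mem : ∀ w ∈ A, x + t • (w - x) ∈ A := fun w hw =>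
    hA.add_smul_sub_mem hx.1.1 hw ⟨ht0.le, ht1.le⟩
  have hmem : x ∈ openSegment ℝ (x + t • (y - x)) (x + t • (z - x)) := by
    have := mem_image_of_mem (AffineMap.homothety x t) hxyz
    rw [image_openSegment] at this
    simpa [AffineMap.homothety_apply, add_comm] using this
  have := hx.2 ⟨shrink_mem y hy, hty⟩ ⟨shrink_mem z hz, htz⟩ hmem
  simpa [ht0.ne', sub_eq_zero] using this

end ExtremePoints

/-! ### Unions of convex sets -/

section Unions

theorem exists_ne_zero_apply_eq_zero {V : Type*} [AddCommGroup V] [Module ℝ V]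
    (hV : 1 < Module.rank ℝ V) (f : Module.Dual ℝ V) : ∃ v : V, v ≠ 0 ∧ f v = 0 := by
  by_contra! h
  have hf : Function.Injective f := (injective_iff_map_eq_zero f).2 fun v hv =>
    by_contra fun hv0 => h v hv0 hv
  have := LinearMap.lift_rank_le_of_injective f hf
  simp only [Module.rank_self, Cardinal.lift_one, Cardinal.lift_uzero] at this
  exact this.not_gt (by simpa using hV)

variable {E : Type*} [AddCommGroup E] [Module ℝ E] [TopologicalSpace E] [IsTopologicalAddGroup E]
  [ContinuousSMul ℝ E]

theorem image_inter_of_convex_union {W : Type*} [AddCommGroup W] [Module ℝ W] {A C : Set E}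
    (hA : IsClosed A) (hC : IsClosed C) (hU : Convex ℝ (A ∪ C)) (p : E →ₗ[ℝ] W) :
    p '' (A ∩ C) = p '' A ∩ p '' C := by
  refine (image_inter_subset p A C).antisymm ?_
  rintro _ ⟨⟨x, hx, rfl⟩, ⟨y, hy, hyx⟩⟩
  obtain ⟨z, hz, hzAC⟩ := isPreconnected_closed_iff.1 (convex_segment x y).isPreconnected
    A C hA hC (hU.segment_subset (Or.inl hx) (Or.inr hy))
    ⟨x, left_mem_segment ℝ x y, hx⟩ ⟨y, right_mem_segment ℝ x y, hy⟩
  refine ⟨z, hzAC, ?_⟩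
  simpa [hyx] using (image_segment ℝ p.toAffineMap x y).subset (mem_image_of_mem p hz)

/-- Otherwise the segment from a maximiser outside `C` to a better point of `C` would leave
`A ∪ C`. -/
theorem toExposed_subset_toExposed_union {A C : Set E} (hU : Convex ℝ (A ∪ C)) (hC : IsClosed C)
    {f : StrongDual ℝ E} {x : E} (hx : x ∈ f.toExposed A) (hxC : x ∉ C) :
    f.toExposed A ⊆ f.toExposed (A ∪ C) := by
  refine fun y hy => ⟨Or.inl hy.1, fun z hz => (hy.2 x hx.1).trans' ?_⟩
  by_contra! hlt
  obtain ⟨t, htC, ht0, ht1⟩ := ((eventually_add_smul_mem (hC.isOpen_compl.mem_nhds hxC)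
    (z - x)).and (Ioo_mem_nhdsGT (one_pos (α := ℝ)))).exists
  have htA : x + t • (z - x) ∈ A :=
    (hU.add_smul_sub_mem (Or.inl hx.1) hz ⟨ht0.le, ht1.le⟩).resolve_right htC
  have hle := hx.2 _ htA
  simp only [map_add, map_smul, map_sub, smul_eq_mul] at hle
  nlinarith [mul_pos ht0 (sub_pos.2 hlt)]

variable {K L : Set E} {x : E}

/-- Near `y`, the points beyond the hyperplane through `y` all belong to `L`. -/
theorem mem_of_mem_interior_union {f : StrongDual ℝ E} (hf0 : f ≠ 0) (hf : ∀ z ∈ K, f z ≤ f x)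
    (hL : IsClosed L) {y : E} (hy : y ∈ interior (K ∪ L)) (hxy : f x ≤ f y) : y ∈ L := by
  obtain ⟨v, hv⟩ : ∃ v, 0 < f v := by
    by_contra! h
    exact hf0 <| ContinuousLinearMap.ext fun v =>
      le_antisymm (h v) (by simpa using h (-v))
  by_contra hyL
  obtain ⟨t, ⟨htU, htL⟩, ht0 : 0 < t⟩ := ((eventually_add_smul_mem (Filter.inter_mem
    (mem_interior_iff_mem_nhds.1 hy) (hL.isOpen_compl.mem_nhds hyL)) v).and
    self_mem_nhdsWithin).exists
  have := hf _ (htU.resolve_right htL)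
  simp only [map_add, map_smul, smul_eq_mul] at this
  nlinarith [mul_pos ht0 hv]

/-- Otherwise `K` and `L` have supporting hyperplanes at `x`. As `K ∪ L` is a neighbourhood of `x`,
these hyperplanes are parallel and, near `x`, they lie in both sets. -/
theorem mem_interior_or_of_mem_extremePoints_inter (hE : 1 < Module.rank ℝ E) (hK : Convex ℝ K)
    (hL : Convex ℝ L) (hKc : IsClosed K) (hLc : IsClosed L) (hKi : (interior K).Nonempty)
    (hLi : (interior L).Nonempty) (hx : x ∈ (K ∩ L).extremePoints ℝ)
    (hxU : x ∈ interior (K ∪ L)) : x ∈ interior K ∨ x ∈ interior L := by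
  by_contra! hnot
  obtain ⟨f, hf0, hf⟩ := geometric_hahn_banach_of_nonempty_interior_point hK hnot.1 hKi
  obtain ⟨g, hg0, hg⟩ := geometric_hahn_banach_of_nonempty_interior_point hL hnot.2 hLi
  obtain ⟨v, hv0, hfv⟩ := exists_ne_zero_apply_eq_zero hE (f : E →ₗ[ℝ] ℝ)
  simp only [ContinuousLinearMap.coe_coe] at hfv
  obtain ⟨t, htadd, htsub, ht0 : 0 < t⟩ :=
    ((eventually_add_smul_mem (isOpen_interior.mem_nhds hxU) v).and
      ((eventually_add_smul_mem (isOpen_interior.mem_nhds hxU) (-v)).and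
        self_mem_nhdsWithin)).exists
  have haddL := mem_of_mem_interior_union hf0 hf hLc htadd (by simp [hfv])
  have hsubL := mem_of_mem_interior_union hf0 hf hLc htsub (by simp [hfv])
  have hgv : g v = 0 := by
    have hadd := hg _ haddL
    have hsub := hg _ hsubL
    simp only [map_add, map_smul, map_neg, smul_eq_mul] at hadd hsub
    nlinarith
  rw [union_comm] at htadd htsub
  have haddK := mem_of_mem_interior_union hg0 hg hKc htadd (by simp [hgv])
  have hsubK := mem_of_mem_interior_union hg0 hg hKc htsub (by simp [hgv])
  exact hv0 <| eq_zero_of_add_smul_mem_of_sub_smul_mem hx ht0 ht0 ⟨haddK, haddL⟩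
    (by simpa [← sub_eq_add_neg] using And.intro hsubK hsubL)

theorem mem_extremePoints_union_of_notMem (hU : Convex ℝ (K ∪ L)) (hL : IsClosed L)
    (hx : x ∈ K.extremePoints ℝ) (hxL : x ∉ L) : x ∈ (K ∪ L).extremePoints ℝ :=
  mem_extremePoints_of_mem_extremePoints_inter_nhds hU (hL.isOpen_compl.mem_nhds hxL) <|
    inter_extremePoints_subset_extremePoints_of_subset (fun _ hy => hy.1.resolve_right hy.2)
      ⟨⟨Or.inl hx.1, hxL⟩, hx⟩

theorem mem_extremePoints_of_mem_interior_of_mem_extremePoints_inter (hL : Convex ℝ L)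
    (hx : x ∈ (K ∩ L).extremePoints ℝ) (hxK : x ∈ interior K) : x ∈ L.extremePoints ℝ :=
  mem_extremePoints_of_mem_extremePoints_inter_nhds hL (mem_interior_iff_mem_nhds.1 hxK)
    (inter_comm K L ▸ hx)

theorem extremePoints_union_union_extremePoints_inter (hE : 1 < Module.rank ℝ E)
    (hK : Convex ℝ K) (hL : Convex ℝ L) (hU : Convex ℝ (K ∪ L)) (hKc : IsClosed K)
    (hLc : IsClosed L) (hKi : (interior K).Nonempty) (hLi : (interior L).Nonempty)
    (hKL : (K ∩ L).extremePoints ℝ ⊆ interior (K ∪ L) ∪ (K ∪ L).extremePoints ℝ) :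
    (K ∪ L).extremePoints ℝ ∪ (K ∩ L).extremePoints ℝ
      = K.extremePoints ℝ ∪ L.extremePoints ℝ := by
  have hUsub : (K ∪ L).extremePoints ℝ ⊆ K.extremePoints ℝ ∪ L.extremePoints ℝ := fun x hx =>
    hx.1.imp
      (fun h => inter_extremePoints_subset_extremePoints_of_subset subset_union_left ⟨h, hx⟩)
      (fun h => inter_extremePoints_subset_extremePoints_of_subset subset_union_right ⟨h, hx⟩)
  refine Subset.antisymm (union_subset hUsub fun x hx => ?_)
    (union_subset (fun x hx => ?_) fun x hx => ?_)
  · rcases hKL hx with hint | hext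
    · rcases mem_interior_or_of_mem_extremePoints_inter hE hK hL hKc hLc hKi hLi hx hint with h | h
      · exact Or.inr (mem_extremePoints_of_mem_interior_of_mem_extremePoints_inter hL hx h)
      · exact Or.inl (mem_extremePoints_of_mem_interior_of_mem_extremePoints_inter hK
          (inter_comm K L ▸ hx) h)
    · exact hUsub hext
  · by_cases hxL : x ∈ L
    · exact Or.inr (inter_extremePoints_subset_extremePoints_of_subset inter_subset_left
        ⟨⟨hx.1, hxL⟩, hx⟩)
    · exact Or.inl (mem_extremePoints_union_of_notMem hU hLc hx hxL)
  · by_cases hxK : x ∈ K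
    · exact Or.inr (inter_extremePoints_subset_extremePoints_of_subset inter_subset_right
        ⟨⟨hxK, hx.1⟩, hx⟩)
    · rw [union_comm K L] at hU ⊢
      exact Or.inl (mem_extremePoints_union_of_notMem hU hKc hx hxK)

theorem extremePoints_union_inter_extremePoints_inter (hE : 1 < Module.rank ℝ E)
    (hK : Convex ℝ K) (hL : Convex ℝ L) (hKc : IsClosed K) (hLc : IsClosed L)
    (hKi : (interior K).Nonempty) (hLi : (interior L).Nonempty)
    (hKL : (K ∩ L).extremePoints ℝ ⊆ interior (K ∪ L) ∪ (K ∪ L).extremePoints ℝ) :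
    (K ∪ L).extremePoints ℝ ∩ (K ∩ L).extremePoints ℝ
      = K.extremePoints ℝ ∩ L.extremePoints ℝ := by
  have : Nontrivial E := rank_pos_iff_nontrivial.1 (one_pos.trans hE)
  refine Subset.antisymm (fun x hx => ?_) fun x hx => ?_
  · exact ⟨inter_extremePoints_subset_extremePoints_of_subset subset_union_left ⟨hx.2.1.1, hx.1⟩,
      inter_extremePoints_subset_extremePoints_of_subset subset_union_right ⟨hx.2.1.2, hx.1⟩⟩
  · have hxKL : x ∈ (K ∩ L).extremePoints ℝ :=
      inter_extremePoints_subset_extremePoints_of_subset inter_subset_left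
        ⟨⟨hx.1.1, hx.2.1⟩, hx.1⟩
    refine ⟨(hKL hxKL).resolve_left fun hint => ?_, hxKL⟩
    rcases mem_interior_or_of_mem_extremePoints_inter hE hK hL hKc hLc hKi hLi hxKL hint with h | h
    · exact (disjoint_interior_extremePoints K).notMem_of_mem_left h hx.1
    · exact (disjoint_interior_extremePoints L).notMem_of_mem_left h hx.2

theorem ncard_extremePoints_union_add_inter (hE : 1 < Module.rank ℝ E) (hK : Convex ℝ K)
    (hL : Convex ℝ L) (hU : Convex ℝ (K ∪ L)) (hKc : IsClosed K) (hLc : IsClosed L)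
    (hKi : (interior K).Nonempty) (hLi : (interior L).Nonempty)
    (hKfin : (K.extremePoints ℝ).Finite) (hLfin : (L.extremePoints ℝ).Finite)
    (hKL : (K ∩ L).extremePoints ℝ ⊆ interior (K ∪ L) ∪ (K ∪ L).extremePoints ℝ) :
    ((K ∪ L).extremePoints ℝ).ncard + ((K ∩ L).extremePoints ℝ).ncard
      = (K.extremePoints ℝ).ncard + (L.extremePoints ℝ).ncard := by
  have hunion := extremePoints_union_union_extremePoints_inter hE hK hL hU hKc hLc hKi hLi hKL
  have hfin : ((K ∪ L).extremePoints ℝ ∪ (K ∩ L).extremePoints ℝ).Finite :=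
    hunion ▸ hKfin.union hLfin
  rw [← ncard_union_add_ncard_inter _ _ (hfin.subset subset_union_left)
    (hfin.subset subset_union_right), hunion,
    extremePoints_union_inter_extremePoints_inter hE hK hL hKc hLc hKi hLi hKL,
    ncard_union_add_ncard_inter _ _ hKfin hLfin]

end Unions

/-! ### Sums with a segment -/

section SegmentSums

variable {V : Type*} [AddCommGroup V] [Module ℝ V]

theorem add_mem_extremePoints_add_iff {A B : Set V} (hA : Convex ℝ A) (hB : Convex ℝ B) {a b : V}
    (ha : a ∈ A) (hb : b ∈ B) :
    a + b ∈ (A + B).extremePoints ℝ ↔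
      a ∈ A.extremePoints ℝ ∧ b ∈ B.extremePoints ℝ ∧
        ∀ a' ∈ A, ∀ b' ∈ B, a' + b' = a + b → a' = a := by
  constructor
  · refine fun h => ⟨⟨ha, fun y hy z hz hyz => ?_⟩, ⟨hb, fun y hy z hz hyz => ?_⟩,
      fun a' ha' b' hb' heq => ?_⟩
    · exact add_right_cancel (h.2 (add_mem_add hy hb) (add_mem_add hz hb)
        (by simpa only [add_comm _ b] using (mem_openSegment_translate ℝ b).2 hyz))
    · exact add_left_cancel (h.2 (add_mem_add ha hy) (add_mem_add ha hz)
        ((mem_openSegment_translate ℝ a).2 hyz))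
    · refine sub_eq_zero.1 (eq_zero_of_add_mem_of_sub_mem h ?_ ?_)
      · exact mem_add.2 ⟨a', ha', b, hb, by abel⟩
      · exact mem_add.2 ⟨a, ha, b', hb', by rw [← heq]; abel⟩
  · rintro ⟨hAa, hBb, huniq⟩
    refine ⟨add_mem_add ha hb, ?_⟩
    rintro _ ⟨a₁, ha₁, b₁, hb₁, rfl⟩ _ ⟨a₂, ha₂, b₂, hb₂, rfl⟩ ⟨s, t, hs, ht, hst, hsum⟩
    have hsum' : (s • a₁ + t • a₂) + (s • b₁ + t • b₂) = a + b := by rw [← hsum]; module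
    have haeq := huniq _ (hA ha₁ ha₂ hs.le ht.le hst) _ (hB hb₁ hb₂ hs.le ht.le hst) hsum'
    have hbeq : s • b₁ + t • b₂ = b := add_left_cancel (haeq ▸ hsum')
    exact congr_arg₂ (· + ·) (hAa.2 ha₁ ha₂ ⟨s, t, hs, ht, hst, haeq⟩)
      (hBb.2 hb₁ hb₂ ⟨s, t, hs, ht, hst, hbeq⟩)

theorem mem_segment_zero_iff {u x : V} : x ∈ segment ℝ 0 u ↔ ∃ t ∈ Icc (0 : ℝ) 1, t • u = x := by
  simp [segment_eq_image']

theorem convexHull_add_segment_zero (s : Set V) (u : V) :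
    convexHull ℝ (s + {0, u}) = convexHull ℝ s + segment ℝ 0 u := by
  rw [convexHull_add, convexHull_pair]

variable {Q : Set V} {u q : V}

theorem mem_extremePoints_add_segment_iff (hQ : Convex ℝ Q) (hq : q ∈ Q.extremePoints ℝ) :
    q ∈ (Q + segment ℝ 0 u).extremePoints ℝ ↔
      ∀ t ∈ Icc (0 : ℝ) 1, q - t • u ∈ Q → t • u = 0 := by
  have h := add_mem_extremePoints_add_iff hQ (convex_segment 0 u) hq.1 (left_mem_segment ℝ 0 u)
  rw [add_zero] at h
  simp only [h, extremePoints_segment, mem_segment_zero_iff]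
  refine ⟨fun ⟨_, _, huniq⟩ t ht hqt => ?_, fun hline => ⟨hq, by simp, ?_⟩⟩
  · simpa using huniq _ hqt _ ⟨t, ht, rfl⟩ (by abel)
  · rintro q' hq' _ ⟨t, ht, rfl⟩ rfl
    simpa using hline t ht (by simpa)

theorem add_mem_extremePoints_add_segment_iff (hQ : Convex ℝ Q) (hq : q ∈ Q.extremePoints ℝ) :
    q + u ∈ (Q + segment ℝ 0 u).extremePoints ℝ ↔
      ∀ t ∈ Icc (0 : ℝ) 1, q + t • u ∈ Q → t • u = 0 := by
  have h := add_mem_extremePoints_add_iff hQ (convex_segment 0 u) hq.1 (right_mem_segment ℝ 0 u)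
  simp only [h, extremePoints_segment, mem_segment_zero_iff]
  refine ⟨fun ⟨_, _, huniq⟩ t ht hqt => ?_, fun hline => ⟨hq, by simp, ?_⟩⟩
  · simpa using huniq _ hqt _ ⟨1 - t, ⟨by linarith [ht.2], by linarith [ht.1]⟩, rfl⟩ (by module)
  · rintro q' hq' _ ⟨t, ht, rfl⟩ heq
    obtain rfl : q' = q + (1 - t) • u := by rw [sub_smul, one_smul, add_sub, ← heq]; abel
    simpa using hline (1 - t) ⟨by linarith [ht.2], by linarith [ht.1]⟩ hq'

theorem extremePoints_add_segment_subset (hQ : Convex ℝ Q) :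
    (Q + segment ℝ 0 u).extremePoints ℝ ⊆ Q.extremePoints ℝ + {0, u} := by
  intro x hx
  obtain ⟨q, hq, b, hb, rfl⟩ := hx.1
  obtain ⟨hq', hb', -⟩ := (add_mem_extremePoints_add_iff hQ (convex_segment 0 u) hq hb).1 hx
  exact add_mem_add hq' (extremePoints_segment 0 u ▸ hb')

/-- The extreme points `q` of `Q` for which the line `q + ℝ u` meets `Q` only at `q`. These are the
extreme points of `Q` lying under two extreme points of the sum `Q + [0, u]`. -/
def lateralPoints (Q : Set V) (u : V) : Set V :=
  {q ∈ Q.extremePoints ℝ | ∀ t : ℝ, q + t • u ∈ Q → t = 0}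

theorem mem_extremePoints_add_segment_or_add_mem (hQ : Convex ℝ Q) (hq : q ∈ Q.extremePoints ℝ) :
    q ∈ (Q + segment ℝ 0 u).extremePoints ℝ ∨ q + u ∈ (Q + segment ℝ 0 u).extremePoints ℝ := by
  rw [mem_extremePoints_add_segment_iff hQ hq, add_mem_extremePoints_add_segment_iff hQ hq]
  by_contra! ⟨⟨s, hs, hsQ, hs0⟩, ⟨t, ht, htQ, ht0⟩⟩
  have hs_pos : 0 < s := hs.1.lt_of_ne' fun h => hs0 (by simp [h])
  have ht_pos : 0 < t := ht.1.lt_of_ne' fun h => ht0 (by simp [h])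
  exact ht0 (by simp [eq_zero_of_add_smul_mem_of_sub_smul_mem hq ht_pos hs_pos htQ hsQ])

theorem mem_lateralPoints_iff (hQ : Convex ℝ Q) (hu : u ≠ 0) (hq : q ∈ Q.extremePoints ℝ) :
    q ∈ lateralPoints Q u ↔
      q ∈ (Q + segment ℝ 0 u).extremePoints ℝ ∧ q + u ∈ (Q + segment ℝ 0 u).extremePoints ℝ := by
  rw [mem_extremePoints_add_segment_iff hQ hq, add_mem_extremePoints_add_segment_iff hQ hq]
  refine ⟨fun h => ⟨fun t _ ht => ?_, fun t _ ht => ?_⟩, fun ⟨hsub, hadd⟩ => ⟨hq, fun t ht => ?_⟩⟩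
  · simp [neg_eq_zero.1 (h.2 (-t) (by simpa [← sub_eq_add_neg]))]
  · simp [h.2 t ht]
  · -- by convexity it suffices to look at the points of the line at distance at most `|u|` from `q`
    have hr : (0 : ℝ) < 1 + |t| := by positivity
    have hmem : q + (t / (1 + |t|)) • u ∈ Q := by
      simpa [smul_smul, div_eq_inv_mul] using hQ.add_smul_sub_mem hq.1 ht
        (t := (1 + |t|)⁻¹) ⟨by positivity, inv_le_one_of_one_le₀ (by simp)⟩
    by_contra ht0
    rcases lt_or_gt_of_ne ht0 with hneg | hpos
    · have := hsub (-(t / (1 + |t|))) ⟨?_, ?_⟩ (by simpa using hmem)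
      · simp [hu, ht0, hr.ne'] at this
      · rw [← neg_div]; exact div_nonneg (by linarith) hr.le
      · rw [← neg_div, div_le_one hr]; linarith [neg_le_abs t]
    · have := hadd (t / (1 + |t|)) ⟨by positivity, ?_⟩ hmem
      · simp [hu, ht0, hr.ne'] at this
      · rw [div_le_one hr]; linarith [le_abs_self t]

theorem ncard_extremePoints_add_segment (hQ : Convex ℝ Q) (hu : u ≠ 0)
    (hfin : (Q.extremePoints ℝ).Finite) :
    ((Q + segment ℝ 0 u).extremePoints ℝ).ncard
      = (Q.extremePoints ℝ).ncard + (lateralPoints Q u).ncard := by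
  set S := (Q + segment ℝ 0 u).extremePoints ℝ
  set lower := {q ∈ Q.extremePoints ℝ | q ∈ S}
  set upper := {q ∈ Q.extremePoints ℝ | q + u ∈ S}
  have hlower : lower.Finite := hfin.sep _
  have hupper : upper.Finite := hfin.sep _
  have hS : S = lower ∪ (· + u) '' upper := by
    refine Subset.antisymm (fun x hx => ?_) (union_subset (fun q hq => hq.2) ?_)
    · obtain ⟨q, hq, b, rfl | rfl, rfl⟩ := extremePoints_add_segment_subset hQ hx
      · exact Or.inl ⟨by simpa using hq, hx⟩
      · exact Or.inr ⟨q, ⟨hq, hx⟩, rfl⟩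
    · rintro _ ⟨q, hq, rfl⟩
      exact hq.2
  have hdisj : Disjoint lower ((· + u) '' upper) := by
    rw [disjoint_right]
    rintro _ ⟨q, hq, rfl⟩ hmem
    have := (mem_extremePoints_add_segment_iff hQ hmem.1).1 hmem.2 1 ⟨zero_le_one, le_rfl⟩
      (by simpa using hq.1.1)
    exact hu (by simpa using this)
  have hunion : lower ∪ upper = Q.extremePoints ℝ :=
    Subset.antisymm (union_subset (sep_subset _ _) (sep_subset _ _)) fun q hq =>
      (mem_extremePoints_add_segment_or_add_mem hQ hq).imp (⟨hq, ·⟩) (⟨hq, ·⟩)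
  have hinter : lower ∩ upper = lateralPoints Q u := by
    ext q
    exact ⟨fun h => (mem_lateralPoints_iff hQ hu h.1.1).2 ⟨h.1.2, h.2.2⟩, fun h =>
      have hS := (mem_lateralPoints_iff hQ hu h.1).1 h
      ⟨⟨h.1, hS.1⟩, ⟨h.1, hS.2⟩⟩⟩
  rw [hS, ncard_union_eq hdisj hlower (hupper.image _),
    ncard_image_of_injective _ (add_left_injective u),
    ← ncard_union_add_ncard_inter lower upper hlower hupper, hunion, hinter]

theorem lateralPoints_segment_eq_empty {a b : V} (hab : a ≠ b) {t : ℝ} (ht : b - a = t • u) :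
    lateralPoints (segment ℝ a b) u = ∅ := by
  have ht0 : t ≠ 0 := by
    rintro rfl
    exact hab (by simpa [sub_eq_zero, eq_comm] using ht)
  refine eq_empty_of_forall_notMem fun q ⟨hq, hline⟩ => ?_
  rw [extremePoints_segment] at hq
  rcases hq with rfl | rfl
  · exact ht0 (hline t (by simp [← ht, right_mem_segment]))
  · exact ht0 (neg_eq_zero.1 (hline (-t) (by simp [← ht, left_mem_segment])))

end SegmentSums

/-! ### Sums of a plane convex set with a segment -/

section LateralPoints

variable {V : Type*} [AddCommGroup V] [Module ℝ V] [TopologicalSpace V] {Q : Set V} {u : V}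
  {φ : StrongDual ℝ V}

theorem toExposed_nonempty (φ : StrongDual ℝ V) (hQ : IsCompact Q) (hne : Q.Nonempty) :
    (φ.toExposed Q).Nonempty := by
  obtain ⟨x, hx, hmax⟩ := hQ.exists_isMaxOn hne φ.continuous.continuousOn
  exact ⟨x, hx, hmax⟩

theorem apply_eq_of_mem_toExposed {x y : V} (hx : x ∈ φ.toExposed Q) (hy : y ∈ φ.toExposed Q) :
    φ x = φ y :=
  le_antisymm (hy.2 x hx.1) (hx.2 y hy.1)

theorem disjoint_toExposed_neg (hconst : ¬ (φ '' Q).Subsingleton) :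
    Disjoint (φ.toExposed Q) ((-φ).toExposed Q) := by
  refine disjoint_left.2 fun x hmax hmin => hconst ?_
  have apply_eq : ∀ y ∈ Q, φ y = φ x := fun y hy =>
    le_antisymm (hmax.2 y hy) (by simpa using hmin.2 y hy)
  rintro _ ⟨y, hy, rfl⟩ _ ⟨z, hz, rfl⟩
  rw [apply_eq y hy, apply_eq z hz]

theorem eq_toExposed_or_eq_neg_toExposed (hQ : Convex ℝ Q) {x : V} (hx : x ∈ Q)
    (hlevel : IsExtreme ℝ Q {y ∈ Q | φ y = φ x}) :
    {y ∈ Q | φ y = φ x} = φ.toExposed Q ∨ {y ∈ Q | φ y = φ x} = (-φ).toExposed Q := by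
  have one_side : (∀ y ∈ Q, φ y ≤ φ x) ∨ ∀ y ∈ Q, φ x ≤ φ y := by
    by_contra! ⟨⟨y, hy, hxy⟩, ⟨z, hz, hzx⟩⟩
    have hmem : φ x ∈ openSegment ℝ (φ z) (φ y) := by
      rw [openSegment_eq_Ioo (hzx.trans hxy)]
      exact ⟨hzx, hxy⟩
    obtain ⟨w, hw, hwx⟩ :=
      (image_openSegment ℝ (φ : V →ₗ[ℝ] ℝ).toAffineMap z y).symm.subset hmem
    exact hzx.ne (hlevel.left_mem_of_mem_openSegment hz hy
      ⟨hQ.openSegment_subset hz hy hw, hwx⟩ hw).2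
  refine one_side.imp (fun hle => ?_) fun hge => ?_ <;> ext y
  · exact ⟨fun h => ⟨h.1, fun z hz => h.2 ▸ hle z hz⟩,
      fun h => ⟨h.1, le_antisymm (hle y h.1) (h.2 x hx)⟩⟩
  · exact ⟨fun h => ⟨h.1, fun z hz => by simpa [h.2] using hge z hz⟩,
      fun h => ⟨h.1, le_antisymm (by simpa using h.2 x hx) (hge y h.1)⟩⟩

theorem mem_lateralPoints_iff_toExposed_eq_singleton (hQ : Convex ℝ Q) (hu : u ≠ 0)
    (hφ : φ.ker = ℝ ∙ u) {q : V} :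
    q ∈ lateralPoints Q u ↔ φ.toExposed Q = {q} ∨ (-φ).toExposed Q = {q} := by
  have mem_ker : ∀ v, φ v = 0 ↔ ∃ t : ℝ, t • u = v := fun v => by
    rw [← Submodule.mem_span_singleton, ← hφ]
    rfl
  have hφu : φ u = 0 := (mem_ker u).2 ⟨1, one_smul ℝ u⟩
  constructor
  · intro hq
    have hlevel : {y ∈ Q | φ y = φ q} = {q} := by
      refine Subset.antisymm (fun y hy => ?_) (by simpa using hq.1.1)
      obtain ⟨t, ht⟩ := (mem_ker (y - q)).1 (by simp [hy.2])
      have hy' : y = q + t • u := by rw [ht]; abel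
      simp [hy', hq.2 t (hy' ▸ hy.1)]
    have := eq_toExposed_or_eq_neg_toExposed hQ hq.1.1 (hlevel ▸ isExtreme_singleton.2 hq.1)
    rw [hlevel] at this
    exact this.imp Eq.symm Eq.symm
  · have of_singleton : ∀ ψ : StrongDual ℝ V, ψ u = 0 → ψ.toExposed Q = {q} →
        q ∈ lateralPoints Q u := by
      intro ψ hψu hψ
      have hq : q ∈ ψ.toExposed Q := hψ ▸ mem_singleton q
      have hexp : IsExposed ℝ Q {q} := hψ ▸ ContinuousLinearMap.toExposed.isExposed
      refine ⟨isExtreme_singleton.1 hexp.isExtreme, fun t ht => ?_⟩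
      have : q + t • u ∈ ψ.toExposed Q := ⟨ht, fun z hz => by simpa [hψu] using hq.2 z hz⟩
      rw [hψ] at this
      simpa [hu] using this
    rintro (h | h)
    · exact of_singleton φ hφu h
    · exact of_singleton (-φ) (by simp [hφu]) h

theorem ncard_lateralPoints_eq_two (hQ : Convex ℝ Q) (hQc : IsCompact Q) (hu : u ≠ 0)
    (hφ : φ.ker = ℝ ∙ u) (hconst : ¬ (φ '' Q).Subsingleton)
    (hmax : (φ.toExposed Q).Subsingleton) (hmin : ((-φ).toExposed Q).Subsingleton) :
    (lateralPoints Q u).ncard = 2 := by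
  have hne : Q.Nonempty := by
    rw [nonempty_iff_ne_empty]
    rintro rfl
    simp at hconst
  obtain ⟨q, hq⟩ := toExposed_nonempty φ hQc hne
  obtain ⟨q', hq'⟩ := toExposed_nonempty (-φ) hQc hne
  rw [ncard_eq_two]
  refine ⟨q, q', ?_, ?_⟩
  · rintro rfl
    exact (disjoint_toExposed_neg hconst).notMem_of_mem_left hq hq'
  · ext x
    rw [mem_lateralPoints_iff_toExposed_eq_singleton hQ hu hφ,
      hmax.eq_singleton_of_mem hq, hmin.eq_singleton_of_mem hq']
    simp [eq_comm]

theorem ncard_lateralPoints_eq_one (hQ : Convex ℝ Q) (hQc : IsCompact Q) (hu : u ≠ 0)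
    (hφ : φ.ker = ℝ ∙ u) (hmax : (φ.toExposed Q).Nontrivial)
    (hmin : ((-φ).toExposed Q).Subsingleton) :
    (lateralPoints Q u).ncard = 1 := by
  obtain ⟨q, hq⟩ := toExposed_nonempty (-φ) hQc (hmax.nonempty.mono fun _ hx => hx.1)
  refine ncard_eq_one.2 ⟨q, ext fun x => ?_⟩
  rw [mem_lateralPoints_iff_toExposed_eq_singleton hQ hu hφ, hmin.eq_singleton_of_mem hq,
    or_iff_right hmax.ne_singleton, singleton_eq_singleton_iff, eq_comm, mem_singleton_iff]

theorem injOn_segment_of_apply_ne {a b : V} (hab : φ a ≠ φ b) : InjOn φ (segment ℝ a b) := by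
  intro x hx y hy hxy
  rw [segment_eq_image'] at hx hy
  obtain ⟨s, -, rfl⟩ := hx
  obtain ⟨t, -, rfl⟩ := hy
  have : s = t := by simpa [sub_eq_zero, hab.symm] using hxy
  rw [this]

theorem level_eq_segment_of_isExtreme {a b : V} (hab : a ≠ b) (hφ : φ.ker = ℝ ∙ u)
    (hφab : φ a = φ b) (hext : IsExtreme ℝ Q (segment ℝ a b)) :
    {y ∈ Q | φ y = φ a} = segment ℝ a b := by
  have exists_smul : ∀ y, φ y = φ a → ∃ t : ℝ, t • u = y - a := fun y hy => by
    rw [← Submodule.mem_span_singleton, ← hφ]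
    exact LinearMap.mem_ker.2 (by simp [hy])
  obtain ⟨t, ht⟩ := exists_smul b hφab.symm
  have ht0 : t ≠ 0 := by
    rintro rfl
    exact hab (by simpa [sub_eq_zero, eq_comm] using ht)
  refine Subset.antisymm (fun y ⟨hyQ, hy⟩ => ?_) fun y hy => ⟨hext.subset hy, ?_⟩
  · obtain ⟨s, hs⟩ := exists_smul y hy
    have hy' : AffineMap.lineMap a b (s / t) = y := by
      rw [AffineMap.lineMap_apply_module', ← ht, smul_smul, div_mul_cancel₀ _ ht0, hs,
        sub_add_cancel]
    exact hy' ▸ lineMap_mem_segment_of_isExtreme hext (hy'.symm ▸ hyQ)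
  · rw [segment_eq_image'] at hy
    obtain ⟨s, -, rfl⟩ := hy
    simp [hφab]

theorem ncard_lateralPoints_eq_one_of_isExtreme (hQ : Convex ℝ Q) (hQc : IsCompact Q)
    {a b : V} (hab : a ≠ b) (hext : IsExtreme ℝ Q (segment ℝ a b))
    (hu : u ≠ 0) (hφ : φ.ker = ℝ ∙ u) (hφab : φ a = φ b) (hconst : ¬ (φ '' Q).Subsingleton)
    (hface : ∀ ψ : StrongDual ℝ V, ψ.ker = ℝ ∙ u →
      (ψ.toExposed Q).Subsingleton ∨ ψ.toExposed Q ⊆ segment ℝ a b) :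
    (lateralPoints Q u).ncard = 1 := by
  have of_eq_toExposed : ∀ ψ : StrongDual ℝ V, ψ.ker = ℝ ∙ u →
      Disjoint (ψ.toExposed Q) ((-ψ).toExposed Q) → segment ℝ a b = ψ.toExposed Q →
      (lateralPoints Q u).ncard = 1 := by
    intro ψ hψ hdisj heq
    refine ncard_lateralPoints_eq_one hQ hQc hu hψ
      (heq ▸ ⟨a, left_mem_segment ℝ a b, b, right_mem_segment ℝ a b, hab⟩)
      ((hface (-ψ) (hψ ▸ LinearMap.ker_neg ψ.toLinearMap)).resolve_right fun hsub => ?_)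
    obtain ⟨q, hq⟩ := toExposed_nonempty (-ψ) hQc ⟨a, hext.subset (left_mem_segment ℝ a b)⟩
    exact hdisj.notMem_of_mem_left (heq.subset (hsub hq)) hq
  have hlevel := level_eq_segment_of_isExtreme hab hφ hφab hext
  rcases eq_toExposed_or_eq_neg_toExposed hQ (hext.subset (left_mem_segment ℝ a b))
    (hlevel.symm ▸ hext) with h | h
  · exact of_eq_toExposed φ hφ (disjoint_toExposed_neg hconst) (hlevel ▸ h)
  · exact of_eq_toExposed (-φ) (hφ ▸ LinearMap.ker_neg φ.toLinearMap)
      ((neg_neg φ).symm ▸ (disjoint_toExposed_neg hconst).symm) (hlevel ▸ h)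

theorem toExposed_subsingleton_of_injOn {ψ : StrongDual ℝ V} {A s : Set V} (hφ : InjOn φ s)
    (hker : ψ.ker = φ.ker) (hsub : ψ.toExposed A ⊆ s) : (ψ.toExposed A).Subsingleton := by
  intro x hx y hy
  have hmem : x - y ∈ ψ.ker := LinearMap.mem_ker.2 (by simp [apply_eq_of_mem_toExposed hx hy])
  rw [hker] at hmem
  exact hφ (hsub hx) (hsub hy) (by simpa [sub_eq_zero] using hmem)

/-- If `u` is not parallel to `[a, b]`, then the two lines parallel to `u` supporting `Q`, or
`[a, b]`, meet it in one point. If `u` is parallel to `[a, b]`, then one of the two lines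
supporting `Q` meets it in `[a, b]`. -/
theorem two_mul_ncard_extremePoints_add_segment [IsTopologicalAddGroup V] [ContinuousSMul ℝ V]
    (hQ : Convex ℝ Q) (hQc : IsCompact Q) (hfin : (Q.extremePoints ℝ).Finite) {a b : V}
    (hab : a ≠ b) (hext : IsExtreme ℝ Q (segment ℝ a b)) (hu : u ≠ 0) (hφ : φ.ker = ℝ ∙ u)
    (hconst : ¬ (φ '' Q).Subsingleton)
    (hface : ∀ ψ : StrongDual ℝ V, ψ.ker = ℝ ∙ u →
      (ψ.toExposed Q).Subsingleton ∨ ψ.toExposed Q ⊆ segment ℝ a b) :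
    2 * ((Q + segment ℝ 0 u).extremePoints ℝ).ncard
      = 2 * (Q.extremePoints ℝ).ncard
        + ((segment ℝ a b + segment ℝ 0 u).extremePoints ℝ).ncard := by
  have hfin' : ((segment ℝ a b).extremePoints ℝ).Finite := by
    rw [extremePoints_segment]
    exact toFinite _
  rw [ncard_extremePoints_add_segment hQ hu hfin,
    ncard_extremePoints_add_segment (convex_segment a b) hu hfin', extremePoints_segment,
    ncard_pair hab]
  suffices 2 * (lateralPoints Q u).ncard = 2 + (lateralPoints (segment ℝ a b) u).ncard by omega
  by_cases hφab : φ a = φ b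
  · obtain ⟨t, ht⟩ := Submodule.mem_span_singleton.1 (hφ ▸ LinearMap.mem_ker.2
      (by simp [hφab] : φ (b - a) = 0))
    rw [lateralPoints_segment_eq_empty hab ht.symm, ncard_empty,
      ncard_lateralPoints_eq_one_of_isExtreme hQ hQc hab hext hu hφ hφab hconst hface]
  · have hinj := injOn_segment_of_apply_ne hφab
    have hker : (-φ).ker = φ.ker := LinearMap.ker_neg φ.toLinearMap
    have hsegment : ¬ (φ '' segment ℝ a b).Subsingleton := fun h =>
      hφab (h (mem_image_of_mem φ (left_mem_segment ℝ a b))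
        (mem_image_of_mem φ (right_mem_segment ℝ a b)))
    have hsegmentc : IsCompact (segment ℝ a b) := by
      rw [segment_eq_image_lineMap]
      exact isCompact_Icc.image AffineMap.lineMap_continuous
    rw [ncard_lateralPoints_eq_two hQ hQc hu hφ hconst
        ((hface φ hφ).elim id (toExposed_subsingleton_of_injOn hinj rfl))
        ((hface (-φ) (hker.trans hφ)).elim id (toExposed_subsingleton_of_injOn hinj hker)),
      ncard_lateralPoints_eq_two (convex_segment a b) hsegmentc hu hφ hsegment
        (toExposed_subsingleton_of_injOn hinj rfl fun _ hx => hx.1)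
        (toExposed_subsingleton_of_injOn hinj hker fun _ hx => hx.1)]

end LateralPoints

/-! ### Convex hulls of finite sets as intersections of half-spaces -/

section Polar

variable {V : Type*} [NormedAddCommGroup V] [InnerProductSpace ℝ V]

/-- The one-sided polar of a set (Mathlib's `LinearMap.polar` is the absolute polar). -/
def polarSet (S : Set V) : Set V :=
  {y | ∀ s ∈ S, inner ℝ s y ≤ 1}

variable {S K : Set V}

theorem polarSet_eq_iInter (S : Set V) :
    polarSet S = ⋂ s ∈ S, innerSL ℝ s ⁻¹' Iic 1 := by
  ext; simp [polarSet]

theorem isClosed_polarSet (S : Set V) : IsClosed (polarSet S) := by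
  rw [polarSet_eq_iInter]
  exact isClosed_biInter fun s _ => isClosed_Iic.preimage (innerSL ℝ s).continuous

theorem convex_polarSet (S : Set V) : Convex ℝ (polarSet S) := by
  rw [polarSet_eq_iInter]
  exact convex_iInter₂ fun s _ =>
    (convex_Iic 1).is_linear_preimage (innerSL ℝ s).toLinearMap.isLinear

theorem subset_polarSet_comm : S ⊆ polarSet K ↔ K ⊆ polarSet S :=
  ⟨fun h k hk s hs => real_inner_comm s k ▸ h hs k hk,
    fun h s hs k hk => real_inner_comm k s ▸ h hk s hs⟩

theorem polarSet_convexHull (S : Set V) : polarSet (convexHull ℝ S) = polarSet S :=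
  Subset.antisymm (fun _ hy s hs => hy s (subset_convexHull ℝ S hs)) <|
    subset_polarSet_comm.1 <| convexHull_min (subset_polarSet_comm.1 Subset.rfl) (convex_polarSet _)

theorem isBounded_polarSet (hS : S ∈ 𝓝 0) : Bornology.IsBounded (polarSet S) := by
  obtain ⟨r, hr, hrS⟩ := Metric.nhds_basis_closedBall.mem_iff.1 hS
  refine (Metric.isBounded_closedBall (x := 0) (r := 1 / r)).subset fun y hy => ?_
  rcases eq_or_ne y 0 with rfl | hy0
  · simp [hr.le]
  have hy1 := hy ((r / ‖y‖) • y) (hrS (by simp [norm_smul, hy0, abs_of_pos hr]))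
  have hnorm : 0 < ‖y‖ := norm_pos_iff.2 hy0
  rw [real_inner_smul_left, real_inner_self_eq_norm_sq] at hy1
  rw [mem_closedBall_zero_iff, le_div_iff₀ hr]
  calc ‖y‖ * r = r / ‖y‖ * ‖y‖ ^ 2 := by field_simp
    _ ≤ 1 := hy1

theorem polarSet_polarSet [CompleteSpace V] (hK : Convex ℝ K) (hKc : IsClosed K) (h0 : 0 ∈ K) :
    polarSet (polarSet K) = K := by
  refine Subset.antisymm (fun x hx => ?_) (subset_polarSet_comm.1 Subset.rfl)
  by_contra hxK
  obtain ⟨f, c, hfK, hcx⟩ := geometric_hahn_banach_closed_point hK hKc hxK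
  have hc : 0 < c := by simpa using hfK 0 h0
  set w := (InnerProductSpace.toDual ℝ V).symm f
  have inner_w : ∀ y, inner ℝ w y = f y := fun y => InnerProductSpace.toDual_symm_apply
  have hw : c⁻¹ • w ∈ polarSet K := fun k hk => by
    rw [real_inner_smul_right, real_inner_comm, inner_w, inv_mul_le_one₀ hc]
    exact (hfK k hk).le
  have := hx _ hw
  rw [real_inner_smul_left, inner_w, inv_mul_le_one₀ hc] at this
  exact this.not_gt hcx

/-- An extreme point is determined by the constraints which are equalities there. -/
theorem finite_extremePoints_polarSet (hS : S.Finite) : ((polarSet S).extremePoints ℝ).Finite := by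
  have active_injOn :
      InjOn (fun y => {s ∈ S | inner ℝ s y = 1}) ((polarSet S).extremePoints ℝ) := by
    intro y hy z _ hyz
    have slack : ∀ v : V, (∀ s ∈ S, inner ℝ s y = 1 → inner ℝ s v = 0) →
        ∀ᶠ t : ℝ in 𝓝[>] 0, y + t • v ∈ polarSet S := by
      intro v hv
      refine (Filter.eventually_all_finite hS).2 fun s hs => ?_
      by_cases hsy : inner ℝ s y = 1
      · simp [inner_add_right, real_inner_smul_right, hv s hs hsy, hsy]
      · have hlt : inner ℝ s y < 1 := (hy.1 s hs).lt_of_ne hsy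
        exact (eventually_add_smul_mem ((isOpen_Iio.preimage (innerSL ℝ s).continuous).mem_nhds
          hlt) v).mono fun t ht => le_of_lt ht
    have hactive : ∀ s ∈ S, inner ℝ s y = 1 → inner ℝ s (z - y) = 0 := fun s hs hsy => by
      have hsz : inner ℝ s z = 1 := ((Set.ext_iff.1 hyz s).1 ⟨hs, hsy⟩).2
      rw [inner_sub_right, hsz, hsy, sub_self]
    obtain ⟨t, htadd, htsub, ht0 : 0 < t⟩ := ((slack _ hactive).and ((slack (-(z - y)) fun s hs h =>
      by rw [inner_neg_right, hactive s hs h, neg_zero]).and self_mem_nhdsWithin)).exists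
    rw [smul_neg, ← sub_eq_add_neg] at htsub
    exact (sub_eq_zero.1 (eq_zero_of_add_smul_mem_of_sub_smul_mem hy ht0 ht0 htadd htsub)).symm
  refine Finite.of_finite_image (hS.finite_subsets.subset ?_) active_injOn
  rintro _ ⟨y, -, rfl⟩
  exact sep_subset _ _

theorem exists_finite_convexHull_eq_polarSet [FiniteDimensional ℝ V] (hS : S.Finite)
    (h0 : convexHull ℝ S ∈ 𝓝 0) : ∃ N : Set V, N.Finite ∧ convexHull ℝ S = polarSet N := by
  have hfin := finite_extremePoints_polarSet hS
  have hcompact : IsCompact (polarSet S) := Metric.isCompact_of_isClosed_isBounded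
    (isClosed_polarSet S) (polarSet_convexHull S ▸ isBounded_polarSet h0)
  have hpolar : convexHull ℝ ((polarSet S).extremePoints ℝ) = polarSet S := by
    rw [← (hfin.isClosed_convexHull ℝ).closure_eq,
      closure_convexHull_extremePoints hcompact (convex_polarSet S)]
  refine ⟨_, hfin, ?_⟩
  rw [← polarSet_convexHull, hpolar, ← polarSet_convexHull S,
    polarSet_polarSet (convex_convexHull ℝ S) (hS.isClosed_convexHull ℝ) (mem_of_mem_nhds h0)]

theorem exists_finite_convexHull_eq_iInter_halfSpaces [FiniteDimensional ℝ V] (hS : S.Finite)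
    (hint : (interior (convexHull ℝ S)).Nonempty) :
    ∃ H : Set (V × ℝ), H.Finite ∧ (∀ h ∈ H, h.1 ≠ 0) ∧
      convexHull ℝ S = {x | ∀ h ∈ H, inner ℝ h.1 x ≤ h.2} := by
  obtain ⟨o, ho⟩ := hint
  have h0 : convexHull ℝ (-o +ᵥ S) ∈ 𝓝 0 := by
    rw [convexHull_vadd, show (0 : V) = -o +ᵥ o by simp, vadd_mem_nhds_vadd_iff]
    exact mem_interior_iff_mem_nhds.1 ho
  obtain ⟨N, hN, hSN⟩ := exists_finite_convexHull_eq_polarSet (hS.vadd_set (a := -o)) h0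
  refine ⟨(fun y => (y, 1 + inner ℝ y o)) '' (N \ {0}), hN.sdiff.image _, ?_, ?_⟩
  · rintro _ ⟨y, hy, rfl⟩
    exact hy.2
  · ext x
    have hx : x ∈ convexHull ℝ S ↔ x - o ∈ polarSet N := by
      rw [← hSN, convexHull_vadd, mem_vadd_set_iff_neg_vadd_mem]
      simp
    rw [hx]
    simp only [polarSet, mem_ofPred_eq, forall_mem_image, inner_sub_right, sub_le_iff_le_add]
    refine ⟨fun h y hy => h y hy.1, fun h y hy => ?_⟩
    rcases eq_or_ne y 0 with rfl | hy0
    · simp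
    · exact h ⟨hy, hy0⟩

end Polar

/-! ### Exposed faces and their dimension -/

section Faces

variable {E W : Type*} [AddCommGroup E] [Module ℝ E] [AddCommGroup W] [Module ℝ W]

theorem injOn_of_disjoint_vectorSpan_ker {A : Set E} {p : E →ₗ[ℝ] W}
    (hA : Disjoint (vectorSpan ℝ A) p.ker) : InjOn p A := fun x hx y hy hxy =>
  sub_eq_zero.1 <| Submodule.disjoint_def.1 hA (x - y) (vsub_mem_vectorSpan ℝ hx hy)
    (by simp [hxy])

theorem disjoint_ker_of_finrank_le_one {S : Submodule ℝ E} [FiniteDimensional ℝ S]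
    {p : E →ₗ[ℝ] W} (hS : Module.finrank ℝ S ≤ 1) {v : E} (hv : v ∈ S) (hpv : p v ≠ 0) :
    Disjoint S p.ker := by
  obtain ⟨v₀, hv₀⟩ := finrank_le_one_iff.1 hS
  obtain ⟨c, hc⟩ := hv₀ ⟨v, hv⟩
  obtain rfl : c • (v₀ : E) = v := congrArg Subtype.val hc
  refine Submodule.disjoint_def.2 fun w hw hpw => ?_
  obtain ⟨t, ht⟩ := hv₀ ⟨w, hw⟩
  obtain rfl : t • (v₀ : E) = w := congrArg Subtype.val ht
  have hpv₀ : p v₀ ≠ 0 := fun h => hpv (by simp [h])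
  have : t = 0 := by simpa [hpv₀] using hpw
  simp [this]

theorem map_eq_top_of_disjoint_ker [FiniteDimensional ℝ W] {S : Submodule ℝ E} {p : E →ₗ[ℝ] W}
    (hS : Disjoint S p.ker) (hfin : Module.finrank ℝ S = Module.finrank ℝ W) : S.map p = ⊤ := by
  have hinj := LinearMap.injective_domRestrict_iff.2 hS
  rw [← LinearMap.range_domRestrict]
  exact Submodule.eq_top_of_finrank_eq ((LinearMap.finrank_range_of_inj hinj).trans hfin)

theorem apply_mem_extremePoints_image_of_finrank_le_one [FiniteDimensional ℝ E] {A : Set E}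
    {x : E} (hA : Convex ℝ A) (hfin : Module.finrank ℝ (vectorSpan ℝ A) ≤ 1)
    (hx : x ∈ A.extremePoints ℝ) (p : E →ₗ[ℝ] W) : p x ∈ (p '' A).extremePoints ℝ := by
  by_cases hp : ∃ v ∈ vectorSpan ℝ A, p v ≠ 0
  · obtain ⟨v, hv, hpv⟩ := hp
    have hinj := injOn_of_disjoint_vectorSpan_ker (disjoint_ker_of_finrank_le_one hfin hv hpv)
    exact (extremePoints_image_of_injOn p.toAffineMap hA hinj).superset (mem_image_of_mem p hx)
  · push Not at hp
    have : p '' A = {p x} := by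
      refine Subset.antisymm ?_ (singleton_subset_iff.2 (mem_image_of_mem p hx.1))
      rintro _ ⟨y, hy, rfl⟩
      simpa [sub_eq_zero] using hp (y - x) (vsub_mem_vectorSpan ℝ hy hx.1)
    simp [this]

theorem vectorSpan_add_segment {A : Set E} (hA : A.Nonempty) (u : E) :
    vectorSpan ℝ (A + segment ℝ 0 u) = vectorSpan ℝ A ⊔ ℝ ∙ u := by
  refine le_antisymm ?_ (sup_le (vectorSpan_mono ℝ fun x hx => ?_) ?_)
  · rw [vectorSpan_def, Submodule.span_le]
    rintro _ ⟨_, ⟨x, hx, v, hv, rfl⟩, _, ⟨y, hy, w, hw, rfl⟩, rfl⟩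
    obtain ⟨s, -, rfl⟩ := mem_segment_zero_iff.1 hv
    obtain ⟨t, -, rfl⟩ := mem_segment_zero_iff.1 hw
    refine Submodule.mem_sup.2 ⟨x - y, vsub_mem_vectorSpan ℝ hx hy, (s - t) • u,
      Submodule.mem_span_singleton.2 ⟨_, rfl⟩, ?_⟩
    simp only [vsub_eq_sub]
    module
  · exact ⟨x, hx, 0, left_mem_segment ℝ 0 u, add_zero x⟩
  · rw [Submodule.span_singleton_le_iff_mem]
    obtain ⟨x, hx⟩ := hA
    simpa using vsub_mem_vectorSpan ℝ (add_mem_add hx (right_mem_segment ℝ 0 u))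
      (add_mem_add hx (left_mem_segment ℝ 0 u))

theorem finrank_vectorSpan_add_segment [FiniteDimensional ℝ E] {A : Set E} {u : E}
    (hA : A.Nonempty) (hu : u ∉ vectorSpan ℝ A) :
    Module.finrank ℝ (vectorSpan ℝ (A + segment ℝ 0 u))
      = Module.finrank ℝ (vectorSpan ℝ A) + 1 := by
  rw [vectorSpan_add_segment hA, Submodule.finrank_sup_span_singleton hu]

theorem subset_of_subset_add_segment {A B e : Set E} {u : E} (hu : u ∉ vectorSpan ℝ B)
    (hA : A ⊆ B) (he : e ⊆ B) (hsub : A ⊆ e + segment ℝ 0 u) : A ⊆ e := by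
  intro x hx
  obtain ⟨y, hy, v, hv, hyv⟩ := hsub hx
  obtain ⟨t, -, rfl⟩ := mem_segment_zero_iff.1 hv
  have ht : t • u ∈ vectorSpan ℝ B := by
    simpa [← hyv] using vsub_mem_vectorSpan ℝ (hA hx) (he hy)
  have : t = 0 := by_contra fun h => hu ((Submodule.smul_mem_iff _ h).1 ht)
  simpa [← hyv, this] using hy

variable [TopologicalSpace E]

theorem vectorSpan_toExposed_le_ker (φ : StrongDual ℝ E) (A : Set E) :
    vectorSpan ℝ (φ.toExposed A) ≤ φ.ker := by
  rw [vectorSpan_def, Submodule.span_le]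
  rintro _ ⟨x, hx, y, hy, rfl⟩
  simp [apply_eq_of_mem_toExposed hx hy]

theorem apply_eq_of_vectorSpan_le_ker {A : Set E} {φ : StrongDual ℝ E}
    (hA : vectorSpan ℝ A ≤ φ.ker) {x y : E} (hx : x ∈ A) (hy : y ∈ A) : φ x = φ y := by
  simpa [sub_eq_zero] using hA (vsub_mem_vectorSpan ℝ hx hy)

theorem not_subsingleton_image [TopologicalSpace W] [FiniteDimensional ℝ W] {A : Set E}
    {p : E →L[ℝ] W} (hA : Module.finrank ℝ (vectorSpan ℝ A) = Module.finrank ℝ W)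
    (hp : Disjoint (vectorSpan ℝ A) p.ker) {φ : StrongDual ℝ W} (hφ : φ ≠ 0) :
    ¬ (φ.comp p '' A).Subsingleton := by
  intro h
  refine hφ (ContinuousLinearMap.ext fun v => ?_)
  obtain ⟨w, hw, rfl⟩ : v ∈ (vectorSpan ℝ A).map (p : E →ₗ[ℝ] W) :=
    map_eq_top_of_disjoint_ker hp hA ▸ Submodule.mem_top
  have hle : vectorSpan ℝ A ≤ (φ.comp p).ker := by
    rw [vectorSpan_def, Submodule.span_le]
    rintro _ ⟨x, hx, y, hy, rfl⟩
    simpa [sub_eq_zero] using h (mem_image_of_mem _ hx) (mem_image_of_mem _ hy)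
  exact hle hw

theorem finrank_vectorSpan_toExposed_eq_one [FiniteDimensional ℝ E] {A : Set E}
    {φ : StrongDual ℝ E} (hA : Module.finrank ℝ (vectorSpan ℝ A) = 2)
    (hconst : ¬ (φ '' A).Subsingleton) (hface : (φ.toExposed A).Nontrivial) :
    Module.finrank ℝ (vectorSpan ℝ (φ.toExposed A)) = 1 := by
  have ne_zero : Module.finrank ℝ (vectorSpan ℝ (φ.toExposed A)) ≠ 0 := by
    rw [Ne, Submodule.finrank_eq_zero, vectorSpan_eq_bot_iff_subsingleton]
    exact hface.not_subsingleton
  have lt : vectorSpan ℝ (φ.toExposed A) < vectorSpan ℝ A := by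
    refine (vectorSpan_mono ℝ fun x hx => hx.1).lt_of_ne fun h => hconst ?_
    rintro _ ⟨x, hx, rfl⟩ _ ⟨y, hy, rfl⟩
    exact apply_eq_of_vectorSpan_le_ker (h ▸ vectorSpan_toExposed_le_ker φ A) hx hy
  have := Submodule.finrank_lt_finrank_of_lt lt
  omega

theorem toExposed_add (φ : StrongDual ℝ E) (A B : Set E) :
    φ.toExposed (A + B) = φ.toExposed A + φ.toExposed B := by
  refine Subset.antisymm ?_ ?_
  · rintro _ ⟨⟨x, hx, y, hy, rfl⟩, hmax⟩
    refine add_mem_add ⟨hx, fun z hz => ?_⟩ ⟨hy, fun z hz => ?_⟩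
    · simpa using hmax (z + y) (add_mem_add hz hy)
    · simpa using hmax (x + z) (add_mem_add hx hz)
  · rintro _ ⟨x, hx, y, hy, rfl⟩
    refine ⟨add_mem_add hx.1 hy.1, ?_⟩
    rintro _ ⟨z, hz, w, hw, rfl⟩
    simpa using add_le_add (hx.2 z hz) (hy.2 w hw)

theorem toExposed_image [TopologicalSpace W] (φ : StrongDual ℝ W) (p : E →L[ℝ] W) (A : Set E) :
    φ.toExposed (p '' A) = p '' (φ.comp p).toExposed A := by
  ext y
  constructor
  · rintro ⟨⟨x, hx, rfl⟩, hmax⟩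
    exact ⟨x, ⟨hx, fun z hz => hmax _ (mem_image_of_mem p hz)⟩, rfl⟩
  · rintro ⟨x, hx, rfl⟩
    exact ⟨mem_image_of_mem p hx.1, forall_mem_image.2 fun z hz => hx.2 z hz⟩

theorem exists_eq_segment_of_injOn {A : Set E} (hA : Convex ℝ A) (hAc : IsCompact A)
    (hne : A.Nonempty) {φ : StrongDual ℝ E} (hφ : InjOn φ A) : ∃ a b, A = segment ℝ a b := by
  obtain ⟨a, ha, hmin⟩ := hAc.exists_isMinOn hne φ.continuous.continuousOn
  obtain ⟨b, hb, hmax⟩ := hAc.exists_isMaxOn hne φ.continuous.continuousOn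
  refine ⟨a, b, Subset.antisymm (fun x hx => ?_) (hA.segment_subset ha hb)⟩
  have hmem : φ x ∈ segment ℝ (φ a) (φ b) := by
    rw [segment_eq_Icc (hmin hb)]
    exact ⟨hmin hx, hmax hx⟩
  obtain ⟨y, hy, hyx⟩ := (image_segment ℝ (φ : E →ₗ[ℝ] ℝ).toAffineMap a b).superset hmem
  exact hφ (hA.segment_subset ha hb hy) hx hyx ▸ hy

theorem exists_eq_segment_of_finrank_eq_one [SeparatingDual ℝ E] {A : Set E} (hA : Convex ℝ A)
    (hAc : IsCompact A) (hfin : Module.finrank ℝ (vectorSpan ℝ A) = 1) :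
    ∃ a b, a ≠ b ∧ A = segment ℝ a b := by
  have hnt : A.Nontrivial := by
    rw [← not_subsingleton_iff, ← vectorSpan_eq_bot_iff_subsingleton (k := ℝ)]
    intro h
    rw [h, finrank_bot] at hfin
    exact zero_ne_one hfin
  obtain ⟨x, hx, y, hy, hxy⟩ := hnt
  obtain ⟨φ, hφ⟩ := SeparatingDual.exists_ne_zero (R := ℝ) (sub_ne_zero.2 hxy)
  have : FiniteDimensional ℝ (vectorSpan ℝ A) := Module.finite_of_finrank_eq_succ hfin
  obtain ⟨a, b, rfl⟩ := exists_eq_segment_of_injOn hA hAc ⟨x, hx⟩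
    (injOn_of_disjoint_vectorSpan_ker (p := (φ : E →ₗ[ℝ] ℝ))
      (disjoint_ker_of_finrank_le_one hfin.le (vsub_mem_vectorSpan ℝ hx hy) hφ))
  refine ⟨a, b, ?_, rfl⟩
  rintro rfl
  rw [segment_same] at hx hy
  exact hxy (hx.trans hy.symm)

/-- Rotate the supporting hyperplane `l = l a` about the face on which `m` is maximal until it
meets `S` again. -/
theorem exists_toExposed_not_subset {S : Set E} (hS : S.Finite) {l m : StrongDual ℝ E} {a : E}
    (ha : a ∈ l.toExposed (convexHull ℝ S)) (hm : ∀ x ∈ l.toExposed (convexHull ℝ S), m x ≤ m a)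
    (hne : (S \ l.toExposed (convexHull ℝ S)).Nonempty) :
    ∃ c : ℝ, a ∈ (m + c • l).toExposed (convexHull ℝ S) ∧
      ¬ (m + c • l).toExposed (convexHull ℝ S) ⊆ l.toExposed (convexHull ℝ S) := by
  have lt_of_notMem : ∀ s ∈ S \ l.toExposed (convexHull ℝ S), l s < l a := fun s hs => by
    by_contra! h
    exact hs.2 ⟨subset_convexHull ℝ S hs.1, fun x hx => (ha.2 x hx).trans h⟩
  obtain ⟨s, hs, hmax⟩ := exists_max_image _ (fun s => (m s - m a) / (l a - l s))
    (hS.subset (sdiff_subset (t := l.toExposed (convexHull ℝ S)))) hne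
  set c := (m s - m a) / (l a - l s) with hc
  have apply_eq : (m + c • l) s = (m + c • l) a := by
    have : l a - l s ≠ 0 := (sub_pos.2 (lt_of_notMem s hs)).ne'
    simp only [hc, add_apply, smul_apply, smul_eq_mul]
    field_simp
    ring
  have apply_le : ∀ t ∈ S, (m + c • l) t ≤ (m + c • l) a := by
    intro t ht
    simp only [add_apply, smul_apply, smul_eq_mul]
    by_cases hte : t ∈ l.toExposed (convexHull ℝ S)
    · simpa [apply_eq_of_mem_toExposed hte ha] using hm t hte
    · have := (div_le_iff₀ (sub_pos.2 (lt_of_notMem t ⟨ht, hte⟩))).1 (hmax t ⟨ht, hte⟩)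
      linarith
  have apply_le_of_mem : ∀ x ∈ convexHull ℝ S, (m + c • l) x ≤ (m + c • l) a :=
    convexHull_min apply_le (convex_halfSpace_le (m + c • l).toLinearMap.isLinear _)
  exact ⟨c, ⟨ha.1, apply_le_of_mem⟩, fun hsub =>
    hs.2 (hsub ⟨subset_convexHull ℝ S hs.1, fun x hx => apply_eq ▸ apply_le_of_mem x hx⟩)⟩

variable [IsTopologicalAddGroup E] [ContinuousSMul ℝ E] [T2Space E] [FiniteDimensional ℝ E]

theorem exists_dual_le_ker_apply_eq_one {S : Submodule ℝ E} {u : E} (hu : u ∉ S) :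
    ∃ φ : StrongDual ℝ E, S ≤ φ.ker ∧ φ u = 1 := by
  obtain ⟨f, hfu, hf⟩ := Submodule.exists_le_ker_of_notMem hu
  refine ⟨(f u)⁻¹ • LinearMap.toContinuousLinearMap f, fun x hx => ?_, ?_⟩
  · simpa [hfu] using hf hx
  · simp [hfu]

theorem isExposed_add_segment_left {B : Set E} {u : E} (hu : u ∉ vectorSpan ℝ B) :
    IsExposed ℝ (B + segment ℝ 0 u) B := by
  obtain ⟨φ, hφ, hφu⟩ := exists_dual_le_ker_apply_eq_one hu
  have hB : (-φ).toExposed B = B := sep_eq_self_iff_mem_true.2 fun x hx y hy => by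
    simp [apply_eq_of_vectorSpan_le_ker hφ hx hy]
  have hsegment : (-φ).toExposed (segment ℝ 0 u) = {0} := by
    refine Subset.antisymm ?_ (singleton_subset_iff.2 ⟨left_mem_segment ℝ 0 u, fun x hx => ?_⟩)
    · rintro x ⟨hx, hmax⟩
      obtain ⟨t, ht, rfl⟩ := mem_segment_zero_iff.1 hx
      have := hmax 0 (left_mem_segment ℝ 0 u)
      have : t = 0 := le_antisymm (by simpa [hφu] using this) ht.1
      simp [this]
    · obtain ⟨t, ht, rfl⟩ := mem_segment_zero_iff.1 hx
      simpa [hφu] using ht.1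
  refine fun _ => ⟨-φ, ?_⟩
  change B = (-φ).toExposed (B + segment ℝ 0 u)
  rw [toExposed_add, hB, hsegment, singleton_zero, add_zero]

/-- Adding to a functional that exposes `e` a multiple of one vanishing on the directions of `B`,
we may assume that it vanishes at `u`. -/
theorem isExposed_add_segment {B e : Set E} {u : E} (hu : u ∉ vectorSpan ℝ B)
    (he : IsExposed ℝ B e) : IsExposed ℝ (B + segment ℝ 0 u) (e + segment ℝ 0 u) := by
  rintro ⟨_, x, hx, -⟩
  obtain ⟨l, rfl⟩ := he ⟨x, hx⟩
  obtain ⟨φ, hφ, hφu⟩ := exists_dual_le_ker_apply_eq_one hu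
  refine ⟨l - l u • φ, ?_⟩
  have hB : (l - l u • φ).toExposed B = l.toExposed B := by
    refine sep_ext_iff.2 fun x hx => forall₂_congr fun y hy => ?_
    simp [apply_eq_of_vectorSpan_le_ker hφ hx hy]
  have hsegment : (l - l u • φ).toExposed (segment ℝ 0 u) = segment ℝ 0 u := by
    refine sep_eq_self_iff_mem_true.2 fun x hx y hy => ?_
    obtain ⟨s, -, rfl⟩ := mem_segment_zero_iff.1 hx
    obtain ⟨t, -, rfl⟩ := mem_segment_zero_iff.1 hy
    simp [hφu]
  change l.toExposed B + segment ℝ 0 u = (l - l u • φ).toExposed (B + segment ℝ 0 u)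
  rw [toExposed_add, hB, hsegment]

end Faces

/-! ### Shadows of prisms -/

theorem exists_dual_ker_eq {V : Type*} [AddCommGroup V] [Module ℝ V] [TopologicalSpace V]
    [IsTopologicalAddGroup V] [ContinuousSMul ℝ V] [T2Space V] [FiniteDimensional ℝ V]
    {S : Submodule ℝ V} (hS : Module.finrank ℝ S + 1 = Module.finrank ℝ V) :
    ∃ φ : StrongDual ℝ V, φ.ker = S := by
  have hne : S ≠ ⊤ := by
    rintro rfl
    rw [finrank_top] at hS
    omega
  obtain ⟨v, -, hv⟩ := SetLike.exists_of_lt hne.lt_top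
  obtain ⟨φ, hφ, hφv⟩ := exists_dual_le_ker_apply_eq_one hv
  refine ⟨φ, (Submodule.eq_of_le_of_finrank_le hφ ?_).symm⟩
  have : φ.ker ≠ ⊤ := fun h =>
    one_ne_zero (hφv.symm.trans (h ▸ Submodule.mem_top : v ∈ φ.ker))
  have := Submodule.finrank_lt this
  omega

theorem interior_nonempty_of_vectorSpan_eq_top {V : Type*} [NormedAddCommGroup V]
    [NormedSpace ℝ V] [FiniteDimensional ℝ V] {A : Set V} (hA : Convex ℝ A) (hne : A.Nonempty)
    (hspan : vectorSpan ℝ A = ⊤) : (interior A).Nonempty :=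
  hA.interior_nonempty_iff_affineSpan_eq_top.2
    ((AffineSubspace.affineSpan_eq_top_iff_vectorSpan_eq_top_of_nonempty ℝ V V hne).2 hspan)

namespace IsConvexPolygon

variable {k : ℕ} {B : Set E3}

theorem convex (hB : IsConvexPolygon k B) : Convex ℝ B := by
  obtain ⟨⟨s, -, rfl⟩, -⟩ := hB
  exact convex_convexHull ℝ s

theorem isCompact (hB : IsConvexPolygon k B) : IsCompact B := by
  obtain ⟨⟨s, hs, rfl⟩, -⟩ := hB
  exact hs.isCompact_convexHull ℝ

theorem nonempty (hB : IsConvexPolygon k B) : B.Nonempty := by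
  by_contra! h
  have := hB.2.1
  rw [h, vectorSpan_empty, finrank_bot] at this
  omega

theorem finite_extremePoints (hB : IsConvexPolygon k B) : (B.extremePoints ℝ).Finite := by
  obtain ⟨⟨s, hs, rfl⟩, -⟩ := hB
  exact hs.subset extremePoints_convexHull_subset

end IsConvexPolygon

namespace IsFaceOfDim

variable {m : ℕ} {B e : Set E3} {u : E3}

theorem nonempty (he : IsFaceOfDim (m + 1) B e) : e.Nonempty := by
  by_contra! h
  have := he.2
  rw [h, vectorSpan_empty, finrank_bot] at this
  omega

theorem exists_eq_segment (hB : Convex ℝ B) (hBc : IsCompact B) (he : IsFaceOfDim 1 B e) :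
    ∃ a b, a ≠ b ∧ e = segment ℝ a b :=
  exists_eq_segment_of_finrank_eq_one (he.1.convex hB) (he.1.isCompact hBc) he.2

theorem sweep (he : IsFaceOfDim (m + 1) B e) (hu : u ∉ vectorSpan ℝ B) :
    IsFaceOfDim (m + 2) (sweep B u) (sweep e u) := by
  refine ⟨isExposed_add_segment hu he.1, ?_⟩
  rw [_root_.sweep, finrank_vectorSpan_add_segment he.nonempty
    fun h => hu (vectorSpan_mono ℝ he.1.subset h), he.2]

theorem exists_subset_face_union {A C f : Set E3} (hU : Convex ℝ (A ∪ C)) (hC : IsClosed C)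
    (hA : vectorSpan ℝ A = ⊤) (hf : IsFaceOfDim 2 A f) (hfC : ¬ f ⊆ C) :
    ∃ g, IsFaceOfDim 2 (A ∪ C) g ∧ f ⊆ g := by
  obtain ⟨hexp, hdim⟩ := hf
  obtain ⟨x, hxf, hxC⟩ := not_subset.1 hfC
  obtain ⟨l, rfl⟩ := hexp ⟨x, hxf⟩
  have hsub : l.toExposed A ⊆ l.toExposed (A ∪ C) :=
    toExposed_subset_toExposed_union hU hC hxf hxC
  have hl : (l : E3 →ₗ[ℝ] ℝ) ≠ 0 := by
    intro h
    have : {x ∈ A | ∀ y ∈ A, l y ≤ l x} = A := sep_eq_self_iff_mem_true.2 fun x _ y _ =>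
      (LinearMap.congr_fun h y).trans (LinearMap.congr_fun h x).symm |>.le
    rw [this, hA, finrank_top, finrank_euclideanSpace_fin] at hdim
    omega
  have hker := Module.Dual.finrank_ker_add_one_of_ne_zero hl
  rw [finrank_euclideanSpace_fin] at hker
  refine ⟨_, ⟨ContinuousLinearMap.toExposed.isExposed, le_antisymm ?_ ?_⟩, hsub⟩
  · exact (Submodule.finrank_mono (vectorSpan_toExposed_le_ker l _)).trans_eq (by omega)
  · exact hdim.ge.trans (Submodule.finrank_mono (vectorSpan_mono ℝ hsub))

end IsFaceOfDim

theorem isFaceOfDim_sweep_left {m : ℕ} {B : Set E3} {u : E3} (hu : u ∉ vectorSpan ℝ B)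
    (hB : Module.finrank ℝ (vectorSpan ℝ B) = m) : IsFaceOfDim m (sweep B u) B :=
  ⟨isExposed_add_segment_left hu, hB⟩

theorem IsConvexPolygon.exists_edge_not_subset {k : ℕ} {B e : Set E3} (hB : IsConvexPolygon k B)
    (he : IsFaceOfDim 1 B e) : ∃ e', IsFaceOfDim 1 B e' ∧ ¬ e' ⊆ e := by
  obtain ⟨a, b, hab, rfl⟩ := he.exists_eq_segment hB.convex hB.isCompact
  obtain ⟨⟨S, hS, rfl⟩, hdim, -⟩ := hB
  have ha := left_mem_segment ℝ a b
  have hb := right_mem_segment ℝ a b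
  obtain ⟨l, hl⟩ := he.1 ⟨a, ha⟩
  change segment ℝ a b = l.toExposed (convexHull ℝ S) at hl
  obtain ⟨m, hm⟩ := SeparatingDual.exists_eq_one (R := ℝ) (sub_ne_zero.2 hab)
  have hmab : m a = m b + 1 := by simpa [sub_eq_iff_eq_add, add_comm] using hm
  have hmax : ∀ x ∈ segment ℝ a b, m x ≤ m a :=
    (convex_halfSpace_le m.toLinearMap.isLinear (m a)).segment_subset
      (le_refl (m a)) (by simp [hmab])
  have hne : (S \ segment ℝ a b).Nonempty := by
    rw [sdiff_nonempty]
    intro h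
    have := Submodule.finrank_mono
      (vectorSpan_mono ℝ (convexHull_min h (convex_segment a b)))
    rw [hdim, he.2] at this
    omega
  rw [hl] at ha hb hmax hne
  obtain ⟨c, hac, hnsub⟩ := exists_toExposed_not_subset hS ha hmax hne
  obtain ⟨x, hx, hxl⟩ := not_subset.1 hnsub
  have hab_ne : (m + c • l) a ≠ (m + c • l) b := by
    simp [hmab, apply_eq_of_mem_toExposed ha hb]
  exact ⟨_, ⟨ContinuousLinearMap.toExposed.isExposed, finrank_vectorSpan_toExposed_eq_one hdim
    (fun h => hab_ne (h (mem_image_of_mem _ ha.1) (mem_image_of_mem _ hb.1)))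
    ⟨a, hac, x, hx, fun h => hxl (h ▸ ha)⟩⟩, hl ▸ hnsub⟩

section Shadow

variable {k : ℕ} {B e : Set E3} {u : E3} {V : Type*} [NormedAddCommGroup V] [NormedSpace ℝ V]
  {p : E3 →L[ℝ] V}

theorem image_sweep (p : E3 →L[ℝ] V) (A : Set E3) (u : E3) :
    p '' sweep A u = p '' A + segment ℝ 0 (p u) := by
  rw [sweep, image_add, ← map_zero p]
  exact congrArg _ (image_segment ℝ (p : E3 →ₗ[ℝ] V).toAffineMap 0 u)

/-- The kernel of `p` is parallel to no (two-dimensional) face of `P` that sticks out of `F`. -/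
def IsTransverseOutside (F P : Set E3) (p : E3 →L[ℝ] V) : Prop :=
  ∀ f, IsFaceOfDim 2 P f → ¬ f ⊆ F → Disjoint (vectorSpan ℝ f) p.ker

namespace IsTransverseOutside

theorem disjoint_base (hp : IsTransverseOutside (sweep e u) (sweep B u) p)
    (hB : IsConvexPolygon k B) (hu : u ∉ vectorSpan ℝ B) (he : IsFaceOfDim 1 B e) :
    Disjoint (vectorSpan ℝ B) p.ker := by
  refine hp B (isFaceOfDim_sweep_left hu hB.2.1) fun h => ?_
  have := Submodule.finrank_mono (vectorSpan_mono ℝ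
    (subset_of_subset_add_segment hu Subset.rfl he.1.subset h))
  rw [hB.2.1, he.2] at this
  omega

theorem disjoint_lateral (hp : IsTransverseOutside (sweep e u) (sweep B u) p)
    (hu : u ∉ vectorSpan ℝ B) (he : IsFaceOfDim 1 B e) {e' : Set E3} (he' : IsFaceOfDim 1 B e')
    (hne : ¬ e' ⊆ e) : Disjoint (vectorSpan ℝ (sweep e' u)) p.ker := by
  have hsub : e' ⊆ sweep e' u := fun x hx => ⟨x, hx, 0, left_mem_segment ℝ 0 u, add_zero x⟩
  exact hp _ (he'.sweep hu) fun h =>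
    hne (subset_of_subset_add_segment hu he'.1.subset he.1.subset (hsub.trans h))

theorem apply_ne_zero (hp : IsTransverseOutside (sweep e u) (sweep B u) p)
    (hB : IsConvexPolygon k B) (hu : u ∉ vectorSpan ℝ B) (he : IsFaceOfDim 1 B e) : p u ≠ 0 := by
  obtain ⟨e', he', hne⟩ := hB.exists_edge_not_subset he
  have hmem : u ∈ vectorSpan ℝ (sweep e' u) := by
    rw [sweep, vectorSpan_add_segment he'.nonempty]
    exact Submodule.mem_sup_right (Submodule.mem_span_singleton_self u)
  intro h
  exact hu (Submodule.disjoint_def.1 (hp.disjoint_lateral hu he he' hne) u hmem h ▸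
    Submodule.zero_mem _)

theorem toExposed_image_subsingleton_or_subset (hV : Module.finrank ℝ V = 2)
    (hp : IsTransverseOutside (sweep e u) (sweep B u) p) (hB : IsConvexPolygon k B)
    (hu : u ∉ vectorSpan ℝ B) (he : IsFaceOfDim 1 B e) {φ : StrongDual ℝ V} (hφ : φ ≠ 0)
    (hφu : φ (p u) = 0) :
    (φ.toExposed (p '' B)).Subsingleton ∨ φ.toExposed (p '' B) ⊆ p '' e := by
  have : FiniteDimensional ℝ V := Module.finite_of_finrank_eq_succ hV
  rw [toExposed_image]
  refine (Set.subsingleton_or_nontrivial ((φ.comp p).toExposed B)).imp (fun h => h.image p)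
    fun hface => ?_
  have hedge : IsFaceOfDim 1 B ((φ.comp p).toExposed B) :=
    ⟨ContinuousLinearMap.toExposed.isExposed, finrank_vectorSpan_toExposed_eq_one hB.2.1
      (not_subsingleton_image (hB.2.1.trans hV.symm) (hp.disjoint_base hB hu he) hφ) hface⟩
  refine image_mono (by_contra fun hne => ?_)
  refine not_subsingleton_image ((hedge.sweep hu).2.trans hV.symm)
    (hp.disjoint_lateral hu he hedge hne) hφ ?_
  rintro _ ⟨_, ⟨x, hx, v, hv, rfl⟩, rfl⟩ _ ⟨_, ⟨y, hy, w, hw, rfl⟩, rfl⟩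
  obtain ⟨s, -, rfl⟩ := mem_segment_zero_iff.1 hv
  obtain ⟨t, -, rfl⟩ := mem_segment_zero_iff.1 hw
  simpa [hφu] using apply_eq_of_mem_toExposed hx hy

theorem two_mul_ncard_extremePoints_image_sweep (hV : Module.finrank ℝ V = 2)
    (hp : IsTransverseOutside (sweep e u) (sweep B u) p)
    (hB : IsConvexPolygon k B) (hu : u ∉ vectorSpan ℝ B) (he : IsFaceOfDim 1 B e) :
    2 * ((p '' sweep B u).extremePoints ℝ).ncard
      = 2 * k + ((p '' sweep e u).extremePoints ℝ).ncard := by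
  have : FiniteDimensional ℝ V := Module.finite_of_finrank_eq_succ hV
  obtain ⟨a, b, hab, rfl⟩ := he.exists_eq_segment hB.convex hB.isCompact
  have hpB := hp.disjoint_base hB hu he
  have hinj : InjOn p B := injOn_of_disjoint_vectorSpan_ker hpB
  have hpab : p a ≠ p b := hinj.ne (he.1.subset (left_mem_segment ℝ a b))
    (he.1.subset (right_mem_segment ℝ a b)) hab
  have hpe : p '' segment ℝ a b = segment ℝ (p a) (p b) :=
    image_segment ℝ (p : E3 →ₗ[ℝ] V).toAffineMap a b
  have hext : (p '' B).extremePoints ℝ = p '' B.extremePoints ℝ :=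
    extremePoints_image_of_injOn (p : E3 →ₗ[ℝ] V).toAffineMap hB.convex hinj
  have hedge : IsExtreme ℝ (p '' B) (segment ℝ (p a) (p b)) :=
    hpe ▸ isExtreme_image_of_injOn (p : E3 →ₗ[ℝ] V).toAffineMap hB.convex hinj he.1.isExtreme
  have hconv : Convex ℝ (p '' B) := hB.convex.linear_image (p : E3 →ₗ[ℝ] V)
  have hpu := hp.apply_ne_zero hB hu he
  have ne_zero_of_ker : ∀ φ : StrongDual ℝ V, φ.ker = ℝ ∙ p u → φ ≠ 0 := by
    rintro _ hφ rfl
    have : (⊤ : Submodule ℝ V) = ℝ ∙ p u := LinearMap.ker_zero.symm.trans hφ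
    rw [← finrank_top ℝ V, this, finrank_span_singleton hpu] at hV
    omega
  obtain ⟨φ, hφ⟩ := exists_dual_ker_eq (S := ℝ ∙ p u) (by rw [finrank_span_singleton hpu, hV])
  rw [image_sweep, image_sweep, hpe, two_mul_ncard_extremePoints_add_segment hconv
    (hB.isCompact.image p.continuous) (hext ▸ hB.finite_extremePoints.image p) hpab hedge hpu hφ,
    hext, (hinj.mono extremePoints_subset).ncard_image, hB.2.2]
  · rw [image_image]
    exact not_subsingleton_image (hB.2.1.trans hV.symm) hpB (ne_zero_of_ker φ hφ)
  · intro ψ hψ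
    rw [← hpe]
    exact toExposed_image_subsingleton_or_subset hV hp hB hu he (ne_zero_of_ker ψ hψ)
      (LinearMap.mem_ker.1 (hψ ▸ Submodule.mem_span_singleton_self (p u)))

end IsTransverseOutside

/-! ### Shadows of bi-prisms -/

/-- A supporting line of the shadow at `p x` pulls back to a face of `P` of dimension at most one:
a two-dimensional one would be parallel to the kernel of `p`. -/
theorem apply_mem_extremePoints_image_of_notMem_interior (hV : Module.finrank ℝ V = 2)
    (hp : Function.Surjective p) {P : Set E3} (hP : Convex ℝ P)
    (hgen : ∀ f, IsFaceOfDim 2 P f → Disjoint (vectorSpan ℝ f) p.ker)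
    (hint : (interior (p '' P)).Nonempty) {x : E3} (hx : x ∈ P.extremePoints ℝ)
    (hpx : p x ∉ interior (p '' P)) : p x ∈ (p '' P).extremePoints ℝ := by
  obtain ⟨φ, hφ, hmax⟩ := geometric_hahn_banach_of_nonempty_interior_point
    (hP.linear_image (p : E3 →ₗ[ℝ] V)) hpx hint
  have : FiniteDimensional ℝ V := Module.finite_of_finrank_eq_succ hV
  set g := (φ.comp p).toExposed P with hg
  have hgexp : IsExposed ℝ P g := ContinuousLinearMap.toExposed.isExposed
  have hxg : x ∈ g := ⟨hx.1, fun y hy => hmax _ (mem_image_of_mem p hy)⟩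
  have hne : ((φ.comp p : StrongDual ℝ E3) : E3 →ₗ[ℝ] ℝ) ≠ 0 := fun h =>
    hφ (ContinuousLinearMap.ext (hp.forall.2 (LinearMap.congr_fun h)))
  have hker := Module.Dual.finrank_ker_add_one_of_ne_zero hne
  have hle : Module.finrank ℝ (vectorSpan ℝ g) ≤ Module.finrank ℝ (φ.comp p).ker :=
    Submodule.finrank_mono (vectorSpan_toExposed_le_ker (φ.comp p) P)
  have hne_two : Module.finrank ℝ (vectorSpan ℝ g) ≠ 2 := by
    intro hdim
    refine not_subsingleton_image (hdim.trans hV.symm) (hgen g ⟨hgexp, hdim⟩) hφ ?_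
    rintro _ ⟨y, hy, rfl⟩ _ ⟨z, hz, rfl⟩
    exact apply_eq_of_mem_toExposed hy hz
  have hgext : p x ∈ (p '' g).extremePoints ℝ :=
    apply_mem_extremePoints_image_of_finrank_le_one (hgexp.convex hP)
      (by rw [finrank_euclideanSpace_fin] at hker; omega)
      (inter_extremePoints_subset_extremePoints_of_subset hgexp.subset ⟨hxg, hx⟩)
      (p : E3 →ₗ[ℝ] V)
  rw [hg, ← toExposed_image] at hgext
  exact ContinuousLinearMap.toExposed.isExposed.isExtreme.extremePoints_subset_extremePoints hgext

namespace IsPrismWithLateralFace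

variable {P F : Set E3}

theorem exists_finite_convexHull (hP : IsPrismWithLateralFace k P F) :
    ∃ T : Set E3, T.Finite ∧ P = convexHull ℝ T := by
  obtain ⟨B, u, ⟨⟨s, hs, rfl⟩, -⟩, -, rfl, -⟩ := hP
  exact ⟨s + {0, u}, hs.add (toFinite _), (convexHull_add_segment_zero s u).symm⟩

theorem convex (hP : IsPrismWithLateralFace k P F) : Convex ℝ P := by
  obtain ⟨T, -, rfl⟩ := hP.exists_finite_convexHull
  exact convex_convexHull ℝ T

theorem isCompact (hP : IsPrismWithLateralFace k P F) : IsCompact P := by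
  obtain ⟨T, hT, rfl⟩ := hP.exists_finite_convexHull
  exact hT.isCompact_convexHull ℝ

theorem nonempty (hP : IsPrismWithLateralFace k P F) : P.Nonempty := by
  obtain ⟨B, u, hB, -, rfl, -⟩ := hP
  exact hB.nonempty.add ⟨0, left_mem_segment ℝ 0 u⟩

theorem vectorSpan_eq_top (hP : IsPrismWithLateralFace k P F) : vectorSpan ℝ P = ⊤ := by
  obtain ⟨B, u, hB, hu, rfl, -⟩ := hP
  refine Submodule.eq_top_of_finrank_eq ?_
  rw [sweep, finrank_vectorSpan_add_segment hB.nonempty hu, hB.2.1, finrank_euclideanSpace_fin]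

theorem finite_extremePoints_image (hP : IsPrismWithLateralFace k P F) (p : E3 →L[ℝ] V) :
    ((p '' P).extremePoints ℝ).Finite := by
  obtain ⟨T, hT, rfl⟩ := hP.exists_finite_convexHull
  have : p '' convexHull ℝ T = convexHull ℝ (p '' T) := (p : E3 →ₗ[ℝ] V).image_convexHull T
  exact this ▸ (hT.image p).subset extremePoints_convexHull_subset

theorem interior_image_nonempty [FiniteDimensional ℝ V] (hP : IsPrismWithLateralFace k P F)
    (hp : Function.Surjective p) : (interior (p '' P)).Nonempty := by
  refine interior_nonempty_of_vectorSpan_eq_top (hP.convex.linear_image (p : E3 →ₗ[ℝ] V))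
    (hP.nonempty.image p) ?_
  have : (vectorSpan ℝ P).map (p : E3 →ₗ[ℝ] V) = vectorSpan ℝ (p '' P) :=
    (p : E3 →ₗ[ℝ] V).toAffineMap.map_vectorSpan
  rw [← this, hP.vectorSpan_eq_top, Submodule.map_top]
  exact LinearMap.range_eq_top.2 hp

theorem two_mul_ncard_extremePoints_image (hP : IsPrismWithLateralFace k P F)
    (hV : Module.finrank ℝ V = 2) (hp : IsTransverseOutside F P p) :
    2 * ((p '' P).extremePoints ℝ).ncard = 2 * k + ((p '' F).extremePoints ℝ).ncard := by
  obtain ⟨B, u, hB, hu, rfl, e, he, rfl⟩ := hP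
  exact hp.two_mul_ncard_extremePoints_image_sweep hV hB hu he

theorem isTransverseOutside (hP : IsPrismWithLateralFace k P F) {C : Set E3}
    (hU : Convex ℝ (P ∪ C)) (hC : IsClosed C) (hF : P ∩ C = F)
    (hp : ∀ f, IsFaceOfDim 2 (P ∪ C) f → Disjoint (vectorSpan ℝ f) p.ker) :
    IsTransverseOutside F P p := by
  intro f hf hfF
  obtain ⟨g, hg, hfg⟩ := hf.exists_subset_face_union hU hC hP.vectorSpan_eq_top
    fun h => hfF (hF ▸ subset_inter hf.1.subset h)
  exact (hp g hg).mono_left (vectorSpan_mono ℝ hfg)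

end IsPrismWithLateralFace

namespace IsBiPrism

variable {k₁ k₂ : ℕ} {P : Set E3}

theorem exists_finite_convexHull (hP : IsBiPrism k₁ k₂ P) :
    ∃ T : Set E3, T.Finite ∧ P = convexHull ℝ T := by
  obtain ⟨P₁, P₂, F, h₁, h₂, -, rfl, hU, -⟩ := hP
  obtain ⟨T₁, hT₁, rfl⟩ := h₁.exists_finite_convexHull
  obtain ⟨T₂, hT₂, rfl⟩ := h₂.exists_finite_convexHull
  refine ⟨T₁ ∪ T₂, hT₁.union hT₂, Subset.antisymm ?_ ?_⟩
  · exact union_subset (convexHull_mono subset_union_left) (convexHull_mono subset_union_right)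
  · exact convexHull_min (union_subset_union (subset_convexHull ℝ T₁) (subset_convexHull ℝ T₂)) hU

theorem vectorSpan_eq_top (hP : IsBiPrism k₁ k₂ P) : vectorSpan ℝ P = ⊤ := by
  obtain ⟨P₁, P₂, F, h₁, -, -, rfl, -⟩ := hP
  exact eq_top_mono (vectorSpan_mono ℝ subset_union_left) h₁.vectorSpan_eq_top

theorem nonempty (hP : IsBiPrism k₁ k₂ P) : P.Nonempty := by
  obtain ⟨P₁, P₂, F, h₁, -, -, rfl, -⟩ := hP
  exact h₁.nonempty.mono subset_union_left

theorem convex (hP : IsBiPrism k₁ k₂ P) : Convex ℝ P := by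
  obtain ⟨P₁, P₂, F, -, -, -, -, hconv, -⟩ := hP
  exact hconv

theorem isConvexPolyhedron (hP : IsBiPrism k₁ k₂ P) : IsConvexPolyhedron P := by
  have hspan := hP.vectorSpan_eq_top
  have hne := hP.nonempty
  obtain ⟨T, hT, rfl⟩ := hP.exists_finite_convexHull
  have hint := interior_nonempty_of_vectorSpan_eq_top (convex_convexHull ℝ T) hne hspan
  exact ⟨(hT.isCompact_convexHull ℝ).isBounded, hint,
    exists_finite_convexHull_eq_iInter_halfSpaces hT hint⟩

theorem ncard_extremePoints_image (hP : IsBiPrism k₁ k₂ P) (hV : Module.finrank ℝ V = 2)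
    (hp : Function.Surjective p)
    (hgen : ∀ f, IsFaceOfDim 2 P f → Disjoint (vectorSpan ℝ f) p.ker) :
    ((p '' P).extremePoints ℝ).ncard = k₁ + k₂ := by
  have : FiniteDimensional ℝ V := Module.finite_of_finrank_eq_succ hV
  obtain ⟨P₁, P₂, F, h₁, h₂, hF, rfl, hU, hext⟩ := hP
  have hcl₁ := h₁.isCompact.isClosed
  have hcl₂ := h₂.isCompact.isClosed
  have hinter : p '' P₁ ∩ p '' P₂ = p '' F :=
    hF ▸ (image_inter_of_convex_union hcl₁ hcl₂ hU (p : E3 →ₗ[ℝ] V)).symm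
  have hunion : p '' P₁ ∪ p '' P₂ = p '' (P₁ ∪ P₂) := (image_union p P₁ P₂).symm
  have hconv₁ : Convex ℝ (p '' P₁) := h₁.convex.linear_image (p : E3 →ₗ[ℝ] V)
  have hconv₂ : Convex ℝ (p '' P₂) := h₂.convex.linear_image (p : E3 →ₗ[ℝ] V)
  have hint := (h₁.interior_image_nonempty hp).mono
    (interior_mono (image_mono (subset_union_left (t := P₂))))
  have hvertices : (p '' P₁ ∩ p '' P₂).extremePoints ℝ ⊆
      interior (p '' P₁ ∪ p '' P₂) ∪ (p '' P₁ ∪ p '' P₂).extremePoints ℝ := by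
    rw [hinter, hunion]
    intro y hy
    have hFc : IsCompact F := hF ▸ h₁.isCompact.inter h₂.isCompact
    obtain ⟨x, hx, rfl⟩ := surjOn_extremePoints_image p.toContinuousAffineMap hFc hy
    exact or_iff_not_imp_left.2
      (apply_mem_extremePoints_image_of_notMem_interior hV hp hU hgen hint (hext hx))
  have hcount := ncard_extremePoints_union_add_inter
    (Module.lt_rank_of_lt_finrank (hV ▸ one_lt_two))
    hconv₁ hconv₂ (hunion ▸ hU.linear_image (p : E3 →ₗ[ℝ] V))
    (h₁.isCompact.image p.continuous).isClosed (h₂.isCompact.image p.continuous).isClosed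
    (h₁.interior_image_nonempty hp) (h₂.interior_image_nonempty hp)
    (h₁.finite_extremePoints_image p) (h₂.finite_extremePoints_image p) hvertices
  have hcount₁ := h₁.two_mul_ncard_extremePoints_image hV (h₁.isTransverseOutside hU hcl₂ hF hgen)
  have hcount₂ := h₂.two_mul_ncard_extremePoints_image hV (h₂.isTransverseOutside
    (union_comm P₁ P₂ ▸ hU) hcl₁ (inter_comm P₁ P₂ ▸ hF) (union_comm P₁ P₂ ▸ hgen))
  rw [hinter, hunion] at hcount
  omega

end IsBiPrism

end Shadow

theorem shadow_eq_image_subtype (d : E3) (P : Set E3) :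
    shadow d P = (ℝ ∙ d)ᗮ.subtype '' ((ℝ ∙ d)ᗮ.orthogonalProjectionOnto '' P) := by
  rw [image_image]
  rfl

theorem ncard_extremePoints_shadow {d : E3} {P : Set E3} (hP : Convex ℝ P) :
    ((shadow d P).extremePoints ℝ).ncard
      = (((ℝ ∙ d)ᗮ.orthogonalProjectionOnto '' P).extremePoints ℝ).ncard := by
  have hext : ((ℝ ∙ d)ᗮ.subtype '' ((ℝ ∙ d)ᗮ.orthogonalProjectionOnto '' P)).extremePoints ℝ
      = (ℝ ∙ d)ᗮ.subtype '' ((ℝ ∙ d)ᗮ.orthogonalProjectionOnto '' P).extremePoints ℝ :=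
    extremePoints_image_of_injOn (ℝ ∙ d)ᗮ.subtype.toAffineMap
      (hP.linear_image ((ℝ ∙ d)ᗮ.orthogonalProjectionOnto : E3 →ₗ[ℝ] (ℝ ∙ d)ᗮ))
      (Submodule.subtype_injective _).injOn
  rw [shadow_eq_image_subtype, hext, ncard_image_of_injective _ (Submodule.subtype_injective _)]

theorem vectorSpan_shadow {d : E3} {P : Set E3} (hP : vectorSpan ℝ P = ⊤) :
    vectorSpan ℝ (shadow d P) = (ℝ ∙ d)ᗮ := by
  have : (vectorSpan ℝ P).map ((ℝ ∙ d)ᗮ.starProjection : E3 →ₗ[ℝ] E3)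
      = vectorSpan ℝ (shadow d P) :=
    ((ℝ ∙ d)ᗮ.starProjection : E3 →ₗ[ℝ] E3).toAffineMap.map_vectorSpan
  rw [← this, hP, Submodule.map_top]
  exact Submodule.range_starProjection _

theorem disjoint_ker_orthogonalProjectionOnto {S : Submodule ℝ E3} {d : E3} (hd : d ∉ S) :
    Disjoint S ((ℝ ∙ d)ᗮ.orthogonalProjectionOnto).ker := by
  rw [Submodule.ker_orthogonalProjectionOnto, Submodule.orthogonal_orthogonal]
  exact Submodule.disjoint_span_singleton_of_notMem hd

theorem mainTheorem7 (k₁ k₂ : ℕ) (P : Set E3) (hP : IsBiPrism k₁ k₂ P) :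
    IsEquiprojective (k₁ + k₂) P := by
  refine ⟨hP.isConvexPolyhedron, fun d hd hface => ?_⟩
  have : Fact (Module.finrank ℝ E3 = 2 + 1) := ⟨finrank_euclideanSpace_fin⟩
  have hplane : Module.finrank ℝ (ℝ ∙ d)ᗮ = 2 := Submodule.finrank_orthogonal_span_singleton hd
  refine ⟨?_, (vectorSpan_shadow hP.vectorSpan_eq_top).symm ▸ hplane, ?_⟩
  · obtain ⟨T, hT, rfl⟩ := hP.exists_finite_convexHull
    exact ⟨_, hT.image _, ((ℝ ∙ d)ᗮ.starProjection : E3 →ₗ[ℝ] E3).image_convexHull T⟩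
  · have hcount := hP.ncard_extremePoints_image hplane
      (p := (ℝ ∙ d)ᗮ.orthogonalProjectionOnto) (fun v => ⟨v, by simp⟩)
      fun f hf => disjoint_ker_orthogonalProjectionOnto (hface f hf)
    rw [ncard_extremePoints_shadow hP.convex, hcount]
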